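/- Let $G$ be a (Hausdorff) locally compact group with a left Haar measure $\mu$, let $1<p<\infty$ and $\frac1p+\frac1q=1$. For $t\in G$ let $L_t$ be the operator $(L_tf)(s)=f(ts)$ on $L^p(G)$, and for $h\in L^\infty(G)$ let $M_h$ be the operator of multiplication by $h$ on $L^p(G)$. Let $\mathcal N^p(G)$ be the Banach space, with the nuclear norm, of nuclear operators on $L^p(G)$, i.e. of operators $\rho=\sum_n f_n\otimes g_n$ with $f_n\in L^p(G)$, $g_n\in L^q(G)$, $\sum_n\|f_n\|_p\|g_n\|_q<\infty$, where $f\otimes g$ is the operator $h\mapsto\bigl(\int_G gh\,d\mu\bigr)f$; put $\operatorname{Tr}\rho=\sum_n\int_G f_ng_n\,d\mu$ and $\langle T,\rho\rangle=\operatorname{Tr}(T\rho)$ for bounded operators $T$ on $L^p(G)$. With the convolution product determined by $\langle T,\rho*\tau\rangle=\langle T\odot\rho,\tau\rangle$ for all bounded $T$, where $T\odot\rho=M_h$ with $h(t)=\langle L_tTL_{t^{-1}},\rho\rangle$, the space $\mathcal N^p(G)$ is a Banach algebra and $\operatorname{Tr}$ is a character of it. Let $\mathbb C_{\operatorname{Tr}}$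 be $\mathbb C$ with the right $\mathcal N^p(G)$-module structure $\lambda\cdot a=\lambda\operatorname{Tr}a$. A right Banach $A$-module $Y$ is called projective if for every sequence $0\to X_1\to X_2\to X_3\to 0$ of right Banach $A$-modules that splits as a sequence of Banach spaces, the sequence $0\to \mathbf h_A(Y,X_1)\to \mathbf h_A(Y,X_2)\to \mathbf h_A(Y,X_3)\to 0$ of spaces of continuous $A$-module morphisms is exact. Then $\mathbb C_{\operatorname{Tr}}$ is a projective right Banach $\mathcal N^p(G)$-module if and only if $G$ is compact. Moreover, if $G$ is compact and $\mu(G)=1$, then $\lambda\mapsto\lambda\,(1\otimes 1)$ is a morphism $\mathbb C_{\operatorname{Tr}}\to\mathcal N^p(G)$ of right $\mathcal N^p(G)$-modules and is a right inverse of $\operatorname{Tr}\colon\mathcal N^p(G)\to\mathbb C_{\operatorname{Tr}}$ (which is the canonical morphism $\mathbb C_{\operatorname{Tr}}\mathbin{\widehat\otimes}\mathcal N^p(G)\to\mathbb C_{\operatorname{Tr}}$, $\lambda\otimes a\mapsto\lambda\cdot a$, after the identification $\mathbb C\mathbin{\widehat\otimes}\mathcal N^p(G)=\mathcal N^p(G)$).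 -/

import Mathlib

noncomputable section

open MeasureTheory Filter Topology
open scoped ENNReal

set_option linter.unusedSectionVars false

namespace NuclearConv

section Abstract

variable {E F : Type*} [NormedAddCommGroup E] [NormedSpace ℂ E]
  [NormedAddCommGroup F] [NormedSpace ℂ F]

/-- `ρ = ∑ i, f i ⊗ g i`, where `f ⊗ g` is the rank-one operator `h ↦ ⟨h, g⟩ f` with respect to
the duality `B` between `E` and `F`, and `∑ i, ‖f i‖ ‖g i‖ < ∞`. -/
structure IsNuclearRep {ι : Type*} (B : E →L[ℂ] F →L[ℂ] ℂ) (ρ : E →L[ℂ] E) (f : ι → E)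
    (g : ι → F) : Prop where
  summable : Summable fun i => ‖f i‖ * ‖g i‖
  hasSum : ∀ h, HasSum (fun i => B h (g i) • f i) (ρ h)

variable {B : E →L[ℂ] F →L[ℂ] ℂ}

namespace IsNuclearRep

variable {ι κ : Type*} {ρ ρ' : E →L[ℂ] E} {f : ι → E} {g : ι → F} {f' : κ → E} {g' : κ → F}

theorem extend (h : IsNuclearRep B ρ f g) {e : ι → κ} (he : Function.Injective e) :
    IsNuclearRep B ρ (Function.extend e f 0) (Function.extend e g 0) ∧
      ∑' k, ‖Function.extend e f 0 k‖ * ‖Function.extend e g 0 k‖ = ∑' i, ‖f i‖ * ‖g i‖ := by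
  have h0 : ∀ k ∉ Set.range e, ‖Function.extend e f 0 k‖ * ‖Function.extend e g 0 k‖ = 0 := by
    intro k hk
    rw [Function.extend_apply' _ _ _ (by simpa using hk)]; simp
  have h1 : ∀ i, ‖Function.extend e f 0 (e i)‖ * ‖Function.extend e g 0 (e i)‖
      = ‖f i‖ * ‖g i‖ := by
    intro i; rw [he.extend_apply, he.extend_apply]
  refine ⟨⟨?_, fun x => ?_⟩, ?_⟩
  · rw [← he.summable_iff h0]
    exact h.summable.congr fun i => (h1 i).symm
  · rw [← he.hasSum_iff]
    · convert h.hasSum x using 2 with i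
      simp [he.extend_apply]
    · intro k hk
      rw [Function.extend_apply' f _ _ (by simpa using hk)]; simp
  · rw [← he.tsum_eq (f := fun k => ‖Function.extend e f 0 k‖ * ‖Function.extend e g 0 k‖)]
    · exact tsum_congr h1
    · intro k hk
      by_contra hk'
      exact hk (h0 k hk')

theorem toNat [Countable ι] (h : IsNuclearRep B ρ f g) : ∃ (f' : ℕ → E) (g' : ℕ → F),
    IsNuclearRep B ρ f' g' ∧ ∑' n, ‖f' n‖ * ‖g' n‖ = ∑' i, ‖f i‖ * ‖g i‖ := by
  obtain ⟨e, he⟩ := Countable.exists_injective_nat ι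
  exact ⟨_, _, h.extend he⟩

theorem neg (h : IsNuclearRep B ρ f g) : IsNuclearRep B (-ρ) f (-g) := by
  refine ⟨by simpa using h.summable, fun x => ?_⟩
  simpa using (h.hasSum x).neg

theorem smul (h : IsNuclearRep B ρ f g) (c : ℂ) : IsNuclearRep B (c • ρ) (c • f) g := by
  refine ⟨?_, fun x => ?_⟩
  · simpa [norm_smul, mul_assoc] using h.summable.mul_left ‖c‖
  · simpa [smul_comm c] using (h.hasSum x).const_smul c

theorem add (h : IsNuclearRep B ρ f g) (h' : IsNuclearRep B ρ' f' g') :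
    IsNuclearRep B (ρ + ρ') (Sum.elim f f') (Sum.elim g g') := by
  refine ⟨?_, fun x => ?_⟩
  · exact (HasSum.sum (f := fun i => ‖Sum.elim f f' i‖ * ‖Sum.elim g g' i‖)
      h.summable.hasSum h'.summable.hasSum).summable
  · exact HasSum.sum (f := fun i => B x (Sum.elim g g' i) • Sum.elim f f' i)
      (h.hasSum x) (h'.hasSum x)

theorem comp_left (h : IsNuclearRep B ρ f g) (T : E →L[ℂ] E) :
    IsNuclearRep B (T ∘L ρ) (fun i => T (f i)) g := by
  refine ⟨?_, fun x => ?_⟩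
  · refine Summable.of_nonneg_of_le (fun i => by positivity) (fun i => ?_)
      (h.summable.mul_left ‖T‖)
    rw [← mul_assoc]
    gcongr
    exact T.le_opNorm _
  · simpa using (h.hasSum x).mapL T

theorem comp_right (h : IsNuclearRep B ρ f g) (S : E →L[ℂ] E) (S' : F →L[ℂ] F)
    (hS : ∀ x y, B (S x) y = B x (S' y)) :
    IsNuclearRep B (ρ ∘L S) f (fun i => S' (g i)) := by
  refine ⟨?_, fun x => ?_⟩
  · refine Summable.of_nonneg_of_le (fun i => by positivity) (fun i => ?_)
      (h.summable.mul_left ‖S'‖)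
    rw [mul_left_comm]
    gcongr
    exact S'.le_opNorm _
  · simpa [hS] using h.hasSum (S x)

theorem opNorm_le (h : IsNuclearRep B ρ f g) : ‖ρ‖ ≤ ‖B‖ * ∑' i, ‖f i‖ * ‖g i‖ := by
  have h0 : 0 ≤ ∑' i, ‖f i‖ * ‖g i‖ := tsum_nonneg fun i => by positivity
  refine ρ.opNorm_le_bound (by positivity) fun x => ?_
  have hs := h.summable.mul_left (‖B‖ * ‖x‖)
  rw [← (h.hasSum x).tsum_eq]
  refine (tsum_of_norm_bounded hs.hasSum fun i => ?_).trans_eq ?_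
  · rw [norm_smul]
    calc _ ≤ (‖B‖ * ‖x‖ * ‖g i‖) * ‖f i‖ := by gcongr; exact B.le_opNorm₂ _ _
      _ = _ := by ring
  · rw [tsum_mul_left]; ring

theorem sigma [CompleteSpace E] {r : κ → E →L[ℂ] E} {a : κ → ι → E} {b : κ → ι → F}
    (hr : ∀ k, IsNuclearRep B (r k) (a k) (b k))
    (hs : Summable fun k => ∑' i, ‖a k i‖ * ‖b k i‖)
    (hρ : ∀ x, HasSum (fun k => r k x) (ρ x)) :
    IsNuclearRep B ρ (fun q : κ × ι => a q.1 q.2) (fun q : κ × ι => b q.1 q.2) ∧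
      ∑' q : κ × ι, ‖a q.1 q.2‖ * ‖b q.1 q.2‖ = ∑' k, ∑' i, ‖a k i‖ * ‖b k i‖ := by
  have hS : Summable fun q : κ × ι => ‖a q.1 q.2‖ * ‖b q.1 q.2‖ :=
    (summable_prod_of_nonneg fun q => by positivity).2 ⟨fun k => (hr k).summable, hs⟩
  refine ⟨⟨hS, fun x => ?_⟩, hS.tsum_prod' fun k => (hr k).summable⟩
  have hS2 : Summable fun q : κ × ι => B x (b q.1 q.2) • a q.1 q.2 := by
    refine Summable.of_norm_bounded (hS.mul_left (‖B‖ * ‖x‖)) fun q => ?_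
    rw [norm_smul]
    calc _ ≤ (‖B‖ * ‖x‖ * ‖b q.1 q.2‖) * ‖a q.1 q.2‖ := by gcongr; exact B.le_opNorm₂ _ _
      _ = _ := by ring
  have h1 := hS2.hasSum.prod_fiberwise fun k => (hr k).hasSum x
  rw [(hρ x).unique h1]
  exact hS2.hasSum

end IsNuclearRep

variable (B) in
/-- The nuclear operators on `E` (with respect to the duality `B`). -/
def nuclearSubmodule : Submodule ℂ (E →L[ℂ] E) where
  carrier := {ρ | ∃ (f : ℕ → E) (g : ℕ → F), IsNuclearRep B ρ f g}
  zero_mem' := ⟨0, 0, ⟨by simp, fun x => by simp⟩⟩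
  add_mem' := by
    rintro ρ ρ' ⟨f, g, h⟩ ⟨f', g', h'⟩
    obtain ⟨a, b, hab, -⟩ := (h.add h').toNat
    exact ⟨a, b, hab⟩
  smul_mem' := by
    rintro c ρ ⟨f, g, h⟩
    exact ⟨_, _, h.smul c⟩

variable (B) in
/-- The space of nuclear operators on `E`; it carries the nuclear norm, see below. -/
def Nuclear : Type _ := nuclearSubmodule B

namespace Nuclear

instance : AddCommGroup (Nuclear B) := inferInstanceAs (AddCommGroup (nuclearSubmodule B))
instance : Module ℂ (Nuclear B) := inferInstanceAs (Module ℂ (nuclearSubmodule B))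

variable (B) in
/-- The underlying operator. -/
def toOp : Nuclear B →ₗ[ℂ] E →L[ℂ] E := (nuclearSubmodule B).subtype

theorem toOp_injective : Function.Injective (toOp B) := Subtype.val_injective

theorem exists_rep (ρ : Nuclear B) : ∃ (f : ℕ → E) (g : ℕ → F), IsNuclearRep B (toOp B ρ) f g :=
  ρ.2

/-- A nuclear operator given by a countable nuclear series. -/
def mk {ι : Type*} [Countable ι] {ρ : E →L[ℂ] E} {f : ι → E} {g : ι → F}
    (h : IsNuclearRep B ρ f g) : Nuclear B :=
  ⟨ρ, by obtain ⟨a, b, hab, -⟩ := h.toNat; exact ⟨a, b, hab⟩⟩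

@[simp] theorem toOp_mk {ι : Type*} [Countable ι] {ρ : E →L[ℂ] E} {f : ι → E} {g : ι → F}
    (h : IsNuclearRep B ρ f g) : toOp B (mk h) = ρ := rfl

/-- The nuclear norm `inf ∑ n, ‖f n‖ ‖g n‖` over all representations. -/
instance : Norm (Nuclear B) where
  norm ρ := sInf {x | ∃ (f : ℕ → E) (g : ℕ → F), IsNuclearRep B (toOp B ρ) f g ∧
    x = ∑' n, ‖f n‖ * ‖g n‖}

theorem norm_le_of_rep {ι : Type*} [Countable ι] {ρ : Nuclear B} {f : ι → E} {g : ι → F}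
    (h : IsNuclearRep B (toOp B ρ) f g) : ‖ρ‖ ≤ ∑' i, ‖f i‖ * ‖g i‖ := by
  obtain ⟨a, b, hab, hsum⟩ := h.toNat
  rw [← hsum]
  refine csInf_le ⟨0, ?_⟩ ⟨a, b, hab, rfl⟩
  rintro x ⟨a, b, -, rfl⟩
  exact tsum_nonneg fun n => by positivity

theorem exists_rep_lt (ρ : Nuclear B) {c : ℝ} (hc : ‖ρ‖ < c) : ∃ (f : ℕ → E) (g : ℕ → F),
    IsNuclearRep B (toOp B ρ) f g ∧ ∑' n, ‖f n‖ * ‖g n‖ < c := by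
  obtain ⟨x, ⟨f, g, h, rfl⟩, hx⟩ := exists_lt_of_csInf_lt (by
    obtain ⟨f, g, h⟩ := ρ.exists_rep
    exact ⟨_, f, g, h, rfl⟩) hc
  exact ⟨f, g, h, hx⟩

theorem norm_nonneg' (ρ : Nuclear B) : 0 ≤ ‖ρ‖ := by
  refine Real.sInf_nonneg ?_
  rintro x ⟨a, b, -, rfl⟩
  exact tsum_nonneg fun n => by positivity

theorem opNorm_le (ρ : Nuclear B) : ‖toOp B ρ‖ ≤ ‖B‖ * ‖ρ‖ := by
  refine le_of_forall_pos_le_add fun ε hε => ?_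
  have : 0 < ε / (‖B‖ + 1) := by positivity
  obtain ⟨f, g, h, hlt⟩ := ρ.exists_rep_lt (lt_add_of_pos_right ‖ρ‖ this)
  calc _ ≤ _ := h.opNorm_le
    _ ≤ ‖B‖ * (‖ρ‖ + ε / (‖B‖ + 1)) := by gcongr
    _ = ‖B‖ * ‖ρ‖ + ε * (‖B‖ / (‖B‖ + 1)) := by ring
    _ ≤ ‖B‖ * ‖ρ‖ + ε * 1 := by
      gcongr
      rw [div_le_one (by positivity)]; linarith
    _ = _ := by ring

theorem exists_of_summable [CompleteSpace E] {κ : Type*} [Countable κ] (u : κ → Nuclear B)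
    (hs : Summable fun k => ‖u k‖) (ρ : E →L[ℂ] E)
    (hρ : ∀ x, HasSum (fun k => toOp B (u k) x) (ρ x)) :
    ∃ v : Nuclear B, toOp B v = ρ ∧ ‖v‖ ≤ ∑' k, ‖u k‖ := by
  have key : ∀ ε > 0, ∃ v : Nuclear B, toOp B v = ρ ∧ ‖v‖ ≤ ∑' k, ‖u k‖ + ε := by
    intro ε hε
    have : Encodable κ := Encodable.ofCountable κ
    obtain ⟨d, hd, c, hdc, hc⟩ := posSumOfEncodable hε κ
    choose a b hab hlt using fun k => (u k).exists_rep_lt (lt_add_of_pos_right ‖u k‖ (hd k))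
    have hsum : Summable fun k => ∑' n, ‖a k n‖ * ‖b k n‖ :=
      Summable.of_nonneg_of_le (fun k => tsum_nonneg fun n => by positivity)
        (fun k => (hlt k).le) (hs.add hdc.summable)
    obtain ⟨h1, h2⟩ := IsNuclearRep.sigma hab hsum hρ
    refine ⟨mk h1, rfl, (norm_le_of_rep (ρ := mk h1) h1).trans ?_⟩
    rw [h2]
    refine (hsum.tsum_le_tsum (fun k => (hlt k).le) (hs.add hdc.summable)).trans ?_
    rw [hs.tsum_add hdc.summable, hdc.tsum_eq]
    linarith
  obtain ⟨v, hv, -⟩ := key 1 one_pos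
  refine ⟨v, hv, le_of_forall_pos_le_add fun ε hε => ?_⟩
  obtain ⟨w, hw, hle⟩ := key ε hε
  rwa [toOp_injective (hv.trans hw.symm)]

theorem normCore : NormedSpace.Core ℂ (Nuclear B) where
  norm_nonneg := norm_nonneg'
  norm_smul := by
    have key : ∀ (c : ℂ) (ρ : Nuclear B), ‖c • ρ‖ ≤ ‖c‖ * ‖ρ‖ := by
      intro c ρ
      refine le_of_forall_pos_le_add fun ε hε => ?_
      obtain ⟨f, g, h, hlt⟩ := ρ.exists_rep_lt
        (lt_add_of_pos_right ‖ρ‖ (by positivity : 0 < ε / (‖c‖ + 1)))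
      have h2 := norm_le_of_rep (ρ := c • ρ) (by simpa using h.smul c)
      simp only [Pi.smul_apply, norm_smul, mul_assoc, tsum_mul_left] at h2
      calc _ ≤ _ := h2
        _ ≤ ‖c‖ * (‖ρ‖ + ε / (‖c‖ + 1)) := by gcongr
        _ = ‖c‖ * ‖ρ‖ + ε * (‖c‖ / (‖c‖ + 1)) := by ring
        _ ≤ ‖c‖ * ‖ρ‖ + ε * 1 := by
          gcongr
          rw [div_le_one (by positivity)]; linarith
        _ = _ := by ring
    intro c ρ
    refine le_antisymm (key c ρ) ?_
    rcases eq_or_ne c 0 with rfl | hc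
    · simpa using norm_nonneg' _
    · have := key c⁻¹ (c • ρ)
      rw [smul_smul, inv_mul_cancel₀ hc, one_smul, norm_inv] at this
      rwa [← div_eq_inv_mul, le_div_iff₀ (by positivity), mul_comm] at this
  norm_triangle := by
    intro ρ τ
    refine le_of_forall_pos_le_add fun ε hε => ?_
    obtain ⟨f, g, h, hlt⟩ := ρ.exists_rep_lt (lt_add_of_pos_right ‖ρ‖ (half_pos hε))
    obtain ⟨f', g', h', hlt'⟩ := τ.exists_rep_lt (lt_add_of_pos_right ‖τ‖ (half_pos hε))
    have h2 := norm_le_of_rep (ρ := ρ + τ) (by simpa using h.add h')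
    have h3 := (HasSum.sum (f := fun i => ‖Sum.elim f f' i‖ * ‖Sum.elim g g' i‖)
      h.summable.hasSum h'.summable.hasSum).tsum_eq
    rw [h3] at h2
    linarith
  norm_eq_zero_iff := by
    intro ρ
    constructor
    · intro h
      apply toOp_injective
      have := ρ.opNorm_le
      rw [h, mul_zero] at this
      simpa using this
    · rintro rfl
      refine le_antisymm ?_ (norm_nonneg' _)
      have h0 : IsNuclearRep B (toOp B 0) (fun _ : Empty => 0) (fun _ : Empty => 0) :=
        ⟨by simp [summable_empty], fun x => by simp [hasSum_empty]⟩
      simpa using norm_le_of_rep h0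

instance : NormedAddCommGroup (Nuclear B) := NormedAddCommGroup.ofCore normCore
instance : NormedSpace ℂ (Nuclear B) := NormedSpace.ofCore normCore

theorem norm_toOp_apply_le (ρ : Nuclear B) (x : E) : ‖toOp B ρ x‖ ≤ ‖B‖ * ‖x‖ * ‖ρ‖ := by
  calc _ ≤ ‖toOp B ρ‖ * ‖x‖ := (toOp B ρ).le_opNorm x
    _ ≤ ‖B‖ * ‖ρ‖ * ‖x‖ := by gcongr; exact ρ.opNorm_le
    _ = _ := by ring

instance [CompleteSpace E] : CompleteSpace (Nuclear B) := by
  refine NormedAddCommGroup.completeSpace_of_summable_imp_tendsto fun u hu => ?_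
  have hs : Summable fun k => toOp B (u k) :=
    Summable.of_norm_bounded (hu.mul_left ‖B‖) fun k => (u k).opNorm_le
  have hρ : ∀ x, HasSum (fun k => toOp B (u k) x) ((∑' k, toOp B (u k)) x) := fun x =>
    hs.hasSum.mapL (ContinuousLinearMap.apply ℂ E x)
  obtain ⟨v, hv, -⟩ := exists_of_summable u hu _ hρ
  refine ⟨v, tendsto_iff_norm_sub_tendsto_zero.2 ?_⟩
  have htail : Tendsto (fun n => ∑' k, ‖u (k + n)‖) atTop (𝓝 0) :=
    tendsto_sum_nat_add fun k => ‖u k‖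
  refine squeeze_zero (fun n => norm_nonneg _) (fun n => ?_) htail
  obtain ⟨w, hw, hle⟩ := exists_of_summable (fun k => u (k + n))
    ((summable_nat_add_iff n).2 hu) (toOp B (v - ∑ i ∈ Finset.range n, u i)) fun x => by
      have := (hasSum_nat_add_iff' n).2 (hρ x)
      simpa [hv] using this
  rw [toOp_injective hw] at hle
  rwa [norm_sub_rev]

/-- Conditions on the duality `B` that make the trace of a nuclear operator well defined and
contractive. -/
class TraceDuality (B : E →L[ℂ] F →L[ℂ] ℂ) : Prop where
  norm_le : ‖B‖ ≤ 1
  trace_zero : ∀ (f : ℕ → E) (g : ℕ → F), IsNuclearRep B 0 f g → ∑' n, B (f n) (g n) = 0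

variable (B) in
theorem norm_pairing_le [TraceDuality B] (x : E) (y : F) : ‖B x y‖ ≤ ‖x‖ * ‖y‖ := by
  calc _ ≤ ‖B‖ * ‖x‖ * ‖y‖ := B.le_opNorm₂ _ _
    _ ≤ 1 * ‖x‖ * ‖y‖ := by gcongr; exact TraceDuality.norm_le
    _ = _ := by ring

theorem summable_trace [TraceDuality B] {ι : Type*} {ρ : E →L[ℂ] E} {f : ι → E} {g : ι → F}
    (h : IsNuclearRep B ρ f g) : Summable fun i => B (f i) (g i) :=
  Summable.of_norm_bounded h.summable fun _ => norm_pairing_le B _ _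

/-- The trace: `Tr (∑ n, f n ⊗ g n) = ∑ n, ⟨f n, g n⟩`. -/
def traceFun (ρ : Nuclear B) : ℂ :=
  ∑' n, B (ρ.exists_rep.choose n) (ρ.exists_rep.choose_spec.choose n)

theorem hasSum_trace [TraceDuality B] {ι : Type*} [Countable ι] {ρ : Nuclear B} {f : ι → E}
    {g : ι → F} (h : IsNuclearRep B (toOp B ρ) f g) :
    HasSum (fun i => B (f i) (g i)) (traceFun ρ) := by
  have h' := ρ.exists_rep.choose_spec.choose_spec
  set f' := ρ.exists_rep.choose
  set g' := ρ.exists_rep.choose_spec.choose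
  have h0 : IsNuclearRep B 0 (Sum.elim f f') (Sum.elim g (-g')) := by
    simpa using h.add h'.neg
  obtain ⟨e, he⟩ := Countable.exists_injective_nat (ι ⊕ ℕ)
  have h1 := TraceDuality.trace_zero _ _ (h0.extend he).1
  have h2 : HasSum (fun i => B (Sum.elim f f' i) (Sum.elim g (-g') i))
      (∑' i, B (f i) (g i) + - ∑' i, B (f' i) (g' i)) := by
    refine HasSum.sum (summable_trace h).hasSum ?_
    have h5 := (summable_trace h').hasSum.neg
    have h6 : ((fun i => B (Sum.elim f f' i) (Sum.elim g (-g') i)) ∘ Sum.inr) =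
        fun i => -B (f' i) (g' i) := by ext i; simp
    rw [h6]
    exact h5
  have h3 : HasSum (fun n => B (Function.extend e (Sum.elim f f') 0 n)
      (Function.extend e (Sum.elim g (-g')) 0 n))
      (∑' i, B (f i) (g i) + - ∑' i, B (f' i) (g' i)) := by
    rw [← he.hasSum_iff]
    · convert h2 using 2 with i
      simp [he.extend_apply]
    · intro k hk
      rw [Function.extend_apply' (Sum.elim f f') _ _ (by simpa using hk)]; simp
  rw [h3.tsum_eq] at h1
  have h4 : ∑' i, B (f i) (g i) = traceFun ρ := by
    rw [← sub_eq_add_neg, sub_eq_zero] at h1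
    exact h1
  rw [← h4]
  exact (summable_trace h).hasSum

variable (B) in
/-- The trace as a continuous linear functional for the nuclear norm. -/
def Tr [TraceDuality B] : Nuclear B →L[ℂ] ℂ :=
  LinearMap.mkContinuous
    { toFun := traceFun
      map_add' := fun ρ τ => by
        obtain ⟨f, g, h⟩ := ρ.exists_rep
        obtain ⟨f', g', h'⟩ := τ.exists_rep
        have h1 := hasSum_trace (ρ := ρ + τ) (by simpa using h.add h')
        exact h1.unique (HasSum.sum (f := fun i => B (Sum.elim f f' i) (Sum.elim g g' i))
          (hasSum_trace h) (hasSum_trace h'))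
      map_smul' := fun c ρ => by
        obtain ⟨f, g, h⟩ := ρ.exists_rep
        have h1 := hasSum_trace (ρ := c • ρ) (by simpa using h.smul c)
        refine h1.unique ?_
        simpa using (hasSum_trace h).mul_left c } 1
    (fun ρ => by
      rw [one_mul]
      refine le_of_forall_pos_le_add fun ε hε => ?_
      obtain ⟨f, g, h, hlt⟩ := ρ.exists_rep_lt (lt_add_of_pos_right ‖ρ‖ hε)
      refine le_trans ?_ hlt.le
      have := (hasSum_trace h).tsum_eq
      change ‖traceFun ρ‖ ≤ _
      rw [← this]
      exact tsum_of_norm_bounded h.summable.hasSum fun _ => norm_pairing_le B _ _)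

theorem hasSum_Tr [TraceDuality B] {ι : Type*} [Countable ι] {ρ : Nuclear B} {f : ι → E}
    {g : ι → F} (h : IsNuclearRep B (toOp B ρ) f g) :
    HasSum (fun i => B (f i) (g i)) (Tr B ρ) := hasSum_trace h

/-- The nuclear operator `T ρ`. -/
def lcomp (T : E →L[ℂ] E) (ρ : Nuclear B) : Nuclear B :=
  mk (ρ.exists_rep.choose_spec.choose_spec.comp_left T)

@[simp] theorem toOp_lcomp (T : E →L[ℂ] E) (ρ : Nuclear B) :
    toOp B (lcomp T ρ) = T ∘L toOp B ρ := rfl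

theorem norm_lcomp_le (T : E →L[ℂ] E) (ρ : Nuclear B) : ‖lcomp T ρ‖ ≤ ‖T‖ * ‖ρ‖ := by
  refine le_of_forall_pos_le_add fun ε hε => ?_
  obtain ⟨f, g, h, hlt⟩ := ρ.exists_rep_lt
    (lt_add_of_pos_right ‖ρ‖ (by positivity : 0 < ε / (‖T‖ + 1)))
  calc _ ≤ _ := norm_le_of_rep (ρ := lcomp T ρ) (h.comp_left T)
    _ ≤ ∑' i, ‖T‖ * (‖f i‖ * ‖g i‖) := by
      refine (h.comp_left T).summable.tsum_le_tsum (fun i => ?_) (h.summable.mul_left _)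
      rw [← mul_assoc]
      gcongr
      exact T.le_opNorm _
    _ = ‖T‖ * ∑' i, ‖f i‖ * ‖g i‖ := tsum_mul_left
    _ ≤ ‖T‖ * (‖ρ‖ + ε / (‖T‖ + 1)) := by gcongr
    _ = ‖T‖ * ‖ρ‖ + ε * (‖T‖ / (‖T‖ + 1)) := by ring
    _ ≤ ‖T‖ * ‖ρ‖ + ε * 1 := by
      gcongr
      rw [div_le_one (by positivity)]; linarith
    _ = _ := by ring

variable (B) in
/-- The trace duality `⟨T, ρ⟩ = Tr (T ρ)` between bounded and nuclear operators. -/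
def pair [TraceDuality B] : (E →L[ℂ] E) →L[ℂ] Nuclear B →L[ℂ] ℂ :=
  LinearMap.mkContinuous₂
    (LinearMap.mk₂ ℂ (fun T ρ => Tr B (lcomp T ρ))
      (fun S T ρ => by
        rw [← map_add]; congr 1)
      (fun c T ρ => by
        rw [← map_smul]; congr 1)
      (fun T ρ τ => by
        rw [← map_add]; congr 1; apply toOp_injective; simp [ContinuousLinearMap.comp_add])
      (fun c T ρ => by
        rw [← map_smul]; congr 1; apply toOp_injective; simp)) 1
    (fun T ρ => by
      rw [one_mul]
      refine le_trans ?_ (norm_lcomp_le T ρ)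
      refine ((Tr B).le_opNorm _).trans ?_
      calc _ ≤ 1 * ‖lcomp T ρ‖ := by
            gcongr
            exact LinearMap.mkContinuous_norm_le _ zero_le_one _
        _ = _ := one_mul _)

theorem pair_apply [TraceDuality B] (T : E →L[ℂ] E) (ρ : Nuclear B) :
    pair B T ρ = Tr B (lcomp T ρ) := rfl

theorem norm_pair_le [TraceDuality B] (T : E →L[ℂ] E) (ρ : Nuclear B) :
    ‖pair B T ρ‖ ≤ ‖T‖ * ‖ρ‖ := by
  have h : ‖pair B‖ ≤ 1 := LinearMap.mkContinuous₂_norm_le _ zero_le_one _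
  calc _ ≤ ‖pair B‖ * ‖T‖ * ‖ρ‖ := (pair B).le_opNorm₂ _ _
    _ ≤ 1 * ‖T‖ * ‖ρ‖ := by gcongr
    _ = _ := by ring

theorem hasSum_pair [TraceDuality B] {ι : Type*} [Countable ι] {ρ : Nuclear B} {f : ι → E}
    {g : ι → F} (h : IsNuclearRep B (toOp B ρ) f g) (T : E →L[ℂ] E) :
    HasSum (fun i => B (T (f i)) (g i)) (pair B T ρ) :=
  hasSum_Tr (ρ := lcomp T ρ) (h.comp_left T)

theorem pair_id [TraceDuality B] (ρ : Nuclear B) :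
    pair B (ContinuousLinearMap.id ℂ E) ρ = Tr B ρ := rfl

theorem ext_pair [TraceDuality B] {ρ τ : Nuclear B} (h : ∀ T, pair B T ρ = pair B T τ) :
    ρ = τ := by
  apply toOp_injective
  ext x
  rw [← sub_eq_zero]
  refine SeparatingDual.eq_zero_of_forall_dual_eq_zero (R := ℂ) fun ψ => ?_
  have key : ∀ σ : Nuclear B, pair B (ψ.smulRight x) σ = ψ (toOp B σ x) := by
    intro σ
    obtain ⟨f, g, hr⟩ := σ.exists_rep
    refine (hasSum_pair hr _).unique ?_
    have := (hr.hasSum x).mapL ψ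
    simpa [mul_comm] using this
  rw [map_sub, ← key, ← key, h, sub_self]

/-- The rank-one operator `f ⊗ g : h ↦ ⟨h, g⟩ f`. -/
def rankOne (f : E) (g : F) : Nuclear B :=
  mk (ρ := (B.flip g).smulRight f) (f := fun _ : Unit => f) (g := fun _ : Unit => g)
    ⟨(hasSum_fintype _).summable, fun x => by simp⟩

@[simp] theorem toOp_rankOne (f : E) (g : F) :
    toOp B (rankOne f g) = (B.flip g).smulRight f := rfl

theorem norm_rankOne_le (f : E) (g : F) : ‖(rankOne f g : Nuclear B)‖ ≤ ‖f‖ * ‖g‖ := by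
  have h : IsNuclearRep B (toOp B (rankOne f g)) (fun _ : Unit => f) (fun _ : Unit => g) :=
    ⟨(hasSum_fintype _).summable, fun x => by simp⟩
  simpa using norm_le_of_rep h

theorem hasSum_rankOne [CompleteSpace E] {ι : Type*} [Countable ι] {ρ : Nuclear B} {f : ι → E}
    {g : ι → F} (h : IsNuclearRep B (toOp B ρ) f g) :
    HasSum (fun i => (rankOne (f i) (g i) : Nuclear B)) ρ := by
  have hs : Summable fun i => (rankOne (f i) (g i) : Nuclear B) :=
    Summable.of_norm_bounded h.summable fun i => norm_rankOne_le _ _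
  convert hs.hasSum
  apply toOp_injective
  ext x
  have h1 := h.hasSum x
  have h2 : HasSum (fun i => toOp B (rankOne (f i) (g i)) x) (toOp B (∑' i, rankOne (f i) (g i)) x) := by
    let l : Nuclear B →L[ℂ] E := LinearMap.mkContinuous
      ((ContinuousLinearMap.apply ℂ E x).toLinearMap ∘ₗ toOp B) (‖B‖ * ‖x‖)
      (fun σ => norm_toOp_apply_le σ x)
    exact hs.hasSum.mapL l
  exact h1.unique (by simpa using h2)

end Nuclear

end Abstract

section Lp

open Nuclear

theorem trace_zero_of_approx {E F : Type*} [NormedAddCommGroup E] [NormedSpace ℂ E]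
    [NormedAddCommGroup F] [NormedSpace ℂ F] (B : E →L[ℂ] F →L[ℂ] ℂ)
    (hB : ‖B‖ ≤ 1)
    (hP : ∀ (f : ℕ → E) (N : ℕ) (ε : ℝ), 0 < ε → ∃ (J : Type) (_ : Fintype J)
      (ψ : J → E →L[ℂ] ℂ) (e : J → E), ‖∑ j, (ψ j).smulRight (e j)‖ ≤ 1 ∧
        ∀ n < N, ‖f n - (∑ j, (ψ j).smulRight (e j)) (f n)‖ ≤ ε)
    (f : ℕ → E) (g : ℕ → F) (h : IsNuclearRep B 0 f g) : ∑' n, B (f n) (g n) = 0 := by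
  have hBb : ∀ x y, ‖B x y‖ ≤ ‖x‖ * ‖y‖ := fun x y => by
    calc _ ≤ ‖B‖ * ‖x‖ * ‖y‖ := B.le_opNorm₂ _ _
      _ ≤ 1 * ‖x‖ * ‖y‖ := by gcongr
      _ = _ := by ring
  rw [← norm_le_zero_iff]
  refine le_of_forall_pos_le_add fun δ hδ => ?_
  rw [zero_add]
  have htail := tendsto_sum_nat_add fun k => ‖f k‖ * ‖g k‖
  obtain ⟨N, hN⟩ := (htail.eventually (gt_mem_nhds (by positivity : 0 < δ / 4))).exists
  set M := ∑ n ∈ Finset.range N, ‖g n‖ with hM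
  have hM0 : 0 ≤ M := Finset.sum_nonneg fun _ _ => norm_nonneg _
  obtain ⟨J, _, ψ, e, hP1, hPf⟩ := hP f N (δ / (2 * (M + 1))) (by positivity)
  set P := ∑ j, (ψ j).smulRight (e j) with hPdef
  have hz : HasSum (fun n => B (P (f n)) (g n)) 0 := by
    have : ∀ n, B (P (f n)) (g n) = ∑ j, ψ j (B (e j) (g n) • f n) := by
      intro n
      simp [hPdef, mul_comm]
    simp_rw [this]
    have h0 : ∀ j ∈ (Finset.univ : Finset J), HasSum (fun n => ψ j (B (e j) (g n) • f n)) 0 := by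
      intro j _
      simpa using (h.hasSum (e j)).mapL (ψ j)
    simpa using hasSum_sum h0
  have hs : Summable fun n => B (f n) (g n) :=
    Summable.of_norm_bounded h.summable fun _ => hBb _ _
  have hd : HasSum (fun n => B (f n - P (f n)) (g n)) (∑' n, B (f n) (g n)) := by
    simpa using hs.hasSum.sub hz
  rw [← hd.tsum_eq, ← hd.summable.sum_add_tsum_nat_add N]
  have hhead : ‖∑ n ∈ Finset.range N, B (f n - P (f n)) (g n)‖ ≤ δ / 2 := by
    calc _ ≤ ∑ n ∈ Finset.range N, δ / (2 * (M + 1)) * ‖g n‖ := by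
          refine norm_sum_le_of_le _ fun n hn => (hBb _ _).trans ?_
          gcongr
          exact hPf n (Finset.mem_range.1 hn)
      _ = δ / 2 * (M / (M + 1)) := by rw [← Finset.mul_sum, ← hM]; field_simp
      _ ≤ δ / 2 * 1 := by
          gcongr
          rw [div_le_one (by positivity)]; linarith
      _ = _ := mul_one _
  have htl : ‖∑' n, B (f (n + N) - P (f (n + N))) (g (n + N))‖ ≤ δ / 2 := by
    have hsN := ((summable_nat_add_iff N).2 h.summable).mul_left 2
    refine (tsum_of_norm_bounded hsN.hasSum fun n => ?_).trans ?_
    · refine (hBb _ _).trans ?_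
      rw [← mul_assoc]
      gcongr
      calc _ ≤ ‖f (n + N)‖ + ‖P (f (n + N))‖ := norm_sub_le _ _
        _ ≤ ‖f (n + N)‖ + 1 * ‖f (n + N)‖ := by gcongr; exact P.le_of_opNorm_le hP1 _
        _ = _ := by ring
    · rw [tsum_mul_left]; linarith
  calc _ ≤ _ := norm_add_le _ _
    _ ≤ δ / 2 + δ / 2 := add_le_add hhead htl
    _ = δ := by ring

variable {X : Type*} [MeasurableSpace X] {μ : Measure X} {p q : ℝ≥0∞}

theorem coeFn_sum' {J : Type*} (t : Finset J) (F : J → Lp ℂ p μ) :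
    ⇑(∑ j ∈ t, F j) =ᵐ[μ] fun x => ∑ j ∈ t, F j x := by
  classical
  induction t using Finset.induction_on with
  | empty => simpa using! Lp.coeFn_zero ℂ p μ
  | insert a t ha ih =>
    rw [Finset.sum_insert ha]
    filter_upwards [Lp.coeFn_add (F a) (∑ j ∈ t, F j), ih] with x h1 h2
    rw [h1, Finset.sum_insert ha, Pi.add_apply, h2]

variable [p.HolderConjugate q] [Fact (1 ≤ p)] [Fact (1 ≤ q)]

variable (μ p q) in
/-- The duality `⟨f, g⟩ = ∫ f g dμ` between `L^p` and `L^q`. -/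
abbrev lpDuality : Lp ℂ p μ →L[ℂ] Lp ℂ q μ →L[ℂ] ℂ :=
  (ContinuousLinearMap.mul ℂ ℂ).lpPairing μ p q

theorem lpDuality_apply (f : Lp ℂ p μ) (g : Lp ℂ q μ) :
    lpDuality μ p q f g = ∫ x, f x * g x ∂μ := by
  simp [ContinuousLinearMap.lpPairing_eq_integral]

theorem norm_lpDuality_le : ‖lpDuality μ p q‖ ≤ 1 := by
  refine ContinuousLinearMap.opNorm_le_bound₂ _ zero_le_one fun f g => ?_
  rw [one_mul]
  have h1 := (ContinuousLinearMap.mul ℂ ℂ).norm_holder_apply_apply_le (r := 1) f g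
  have h2 : lpDuality μ p q f g = L1.integral ((ContinuousLinearMap.mul ℂ ℂ).holder 1 f g) := by
    rw [L1.integral_eq_integral, ContinuousLinearMap.lpPairing_eq_integral]
    exact integral_congr_ae ((ContinuousLinearMap.mul ℂ ℂ).coeFn_holder f g).symm
  rw [h2]
  refine (L1.norm_integral_le _).trans (h1.trans ?_)
  calc _ ≤ 1 * ‖f‖ * ‖g‖ := by gcongr; exact ContinuousLinearMap.opNorm_mul_le ℂ ℂ
    _ = _ := by ring

theorem average_rpow_le (hp' : p ≠ ∞) {A : Set X} (hμ : μ A ≠ ∞)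
    (f : Lp ℂ p μ) :
    ‖((μ A).toReal⁻¹ : ℂ) * ∫ x in A, f x ∂μ‖ₑ ^ p.toReal * μ A
      ≤ ∫⁻ x in A, ‖f x‖ₑ ^ p.toReal ∂μ := by
  have hp1 : 1 ≤ p := Fact.out
  have hp0 : p ≠ 0 := (zero_lt_one.trans_le hp1).ne'
  have hpr : 0 < p.toReal := ENNReal.toReal_pos hp0 hp'
  rcases eq_or_ne (μ A) 0 with h0 | h0
  · simp [h0]
  have h1 : ‖∫ x in A, f x ∂μ‖ₑ ≤ eLpNorm f 1 (μ.restrict A) := by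
    rw [eLpNorm_one_eq_lintegral_enorm]
    exact enorm_integral_le_lintegral_enorm _
  have h2 := eLpNorm_le_eLpNorm_mul_rpow_measure_univ hp1
    ((Lp.aestronglyMeasurable f).restrict (s := A))
  have h3 : ‖((μ A).toReal⁻¹ : ℂ)‖ₑ = (μ A)⁻¹ := by
    have : ‖((μ A).toReal : ℂ)‖ₑ = μ A := by
      rw [← ofReal_norm, Complex.norm_real, Real.norm_of_nonneg ENNReal.toReal_nonneg,
        ENNReal.ofReal_toReal hμ]
    rw [enorm_inv, this]
    simpa using ENNReal.toReal_ne_zero.2 ⟨h0, hμ⟩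
  have h4 : eLpNorm f p (μ.restrict A) ^ p.toReal = ∫⁻ x in A, ‖f x‖ₑ ^ p.toReal ∂μ := by
    rw [eLpNorm_eq_lintegral_rpow_enorm_toReal hp0 hp', ← ENNReal.rpow_mul,
      one_div_mul_cancel hpr.ne', ENNReal.rpow_one]
  rw [enorm_mul, h3, ← h4]
  calc _ ≤ ((μ A)⁻¹ * (eLpNorm f p (μ.restrict A) *
        μ A ^ (1 - 1 / p.toReal))) ^ p.toReal * μ A := by
        gcongr
        refine h1.trans ?_
        simpa using h2
    _ = eLpNorm f p (μ.restrict A) ^ p.toReal *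
        ((μ A)⁻¹ ^ p.toReal * (μ A ^ (1 - 1 / p.toReal)) ^ p.toReal * μ A) := by
        rw [ENNReal.mul_rpow_of_nonneg _ _ hpr.le, ENNReal.mul_rpow_of_nonneg _ _ hpr.le]
        ring
    _ = eLpNorm f p (μ.restrict A) ^ p.toReal * 1 := by
        congr 1
        rw [← ENNReal.rpow_mul, ← ENNReal.rpow_neg_one, ← ENNReal.rpow_mul]
        nth_rewrite 3 [← ENNReal.rpow_one (μ A)]
        rw [← ENNReal.rpow_add _ _ h0 hμ, ← ENNReal.rpow_add _ _ h0 hμ]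
        convert ENNReal.rpow_zero
        field_simp
        ring
    _ ≤ _ := by rw [mul_one]

theorem exists_averaging (q : ℝ≥0∞) [p.HolderConjugate q] [Fact (1 ≤ q)] (hp' : p ≠ ∞) {V : Type*} [NormedAddCommGroup V]
    (s : SimpleFunc X V) (hs : MemLp s p μ) :
    ∃ (ψ : {v // v ∈ s.range} → Lp ℂ p μ →L[ℂ] ℂ) (e : {v // v ∈ s.range} → Lp ℂ p μ),
      ‖∑ j, (ψ j).smulRight (e j)‖ ≤ 1 ∧
      ∀ (u : V → ℂ) (_ : u 0 = 0) (f : Lp ℂ p μ), (⇑f =ᵐ[μ] fun x => u (s x)) →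
        (∑ j, (ψ j).smulRight (e j)) f = f := by
  classical
  have hp1 : 1 ≤ p := Fact.out
  have hp0 : p ≠ 0 := (zero_lt_one.trans_le hp1).ne'
  have hpr : 0 < p.toReal := ENNReal.toReal_pos hp0 hp'
  have hfin : ∀ v, v ≠ 0 → μ (s ⁻¹' {v}) ≠ ∞ := fun v hv =>
    (SimpleFunc.measure_preimage_lt_top_of_memLp hp0 hp' s hs v hv).ne
  have hmeas : ∀ v, MeasurableSet (s ⁻¹' {v}) := s.measurableSet_fiber
  let ψ : V → Lp ℂ p μ →L[ℂ] ℂ := fun v =>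
    if hv : v = 0 then 0 else ((μ (s ⁻¹' {v})).toReal⁻¹ : ℂ) •
      (lpDuality μ p q).flip (indicatorConstLp q (hmeas v) (hfin v hv) 1)
  let e : V → Lp ℂ p μ := fun v =>
    if hv : v = 0 then 0 else indicatorConstLp p (hmeas v) (hfin v hv) 1
  have hψ0 : ψ 0 = 0 := by simp [ψ]
  have hψ : ∀ v, v ≠ 0 → ∀ f, ψ v f =
      ((μ (s ⁻¹' {v})).toReal⁻¹ : ℂ) * ∫ x in s ⁻¹' {v}, f x ∂μ := by
    intro v hv f
    simp only [ψ, dif_neg hv, _root_.smul_apply, ContinuousLinearMap.flip_apply,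
      smul_eq_mul]
    rw [lpDuality_apply, ← integral_indicator (hmeas v)]
    congr 1
    refine integral_congr_ae ?_
    filter_upwards [indicatorConstLp_coeFn (p := q) (hs := hmeas v) (hμs := hfin v hv)
      (c := (1 : ℂ))] with x hx
    rw [hx]
    by_cases hxv : x ∈ s ⁻¹' {v}
    · simp only [Set.indicator_of_mem hxv, mul_one]
    · simp only [Set.indicator_of_notMem hxv, mul_zero]
  have hPae : ∀ f, ⇑((∑ j : {v // v ∈ s.range}, (ψ j).smulRight (e j)) f)
      =ᵐ[μ] fun x => ψ (s x) f := by
    intro f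
    have h1 : (∑ j : {v // v ∈ s.range}, (ψ j).smulRight (e j)) f =
        ∑ v ∈ s.range, ψ v f • e v := by
      rw [_root_.sum_apply, ← Finset.sum_coe_sort s.range fun v => ψ v f • e v]
      rfl
    have h2 : ∀ v ∈ s.range, ∀ᵐ x ∂μ, (ψ v f • e v : Lp ℂ p μ) x =
        if v = s x then ψ v f else 0 := by
      intro v _
      by_cases hv : v = 0
      · have hz : (ψ v f • e v : Lp ℂ p μ) = 0 := by simp [hv, hψ0]
        rw [hz]
        filter_upwards [Lp.coeFn_zero ℂ p μ] with x hx
        rw [hx]; simp [hv, hψ0]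
      · filter_upwards [Lp.coeFn_smul (ψ v f) (e v),
          indicatorConstLp_coeFn (p := p) (hs := hmeas v) (hμs := hfin v hv)
          (c := (1 : ℂ))] with x hx1 hx2
        rw [hx1]
        simp only [Pi.smul_apply, smul_eq_mul]
        have : e v = indicatorConstLp p (hmeas v) (hfin v hv) 1 := dif_neg hv
        rw [this, hx2]
        by_cases hxv : v = s x
        · rw [Set.indicator_of_mem (by simp [hxv])]; simp [hxv]
        · rw [Set.indicator_of_notMem (by simpa using fun h => hxv h.symm)]; simp [hxv]
    rw [h1]
    filter_upwards [coeFn_sum' s.range fun v => ψ v f • e v,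
      (Filter.eventually_all_finset s.range).2 h2] with x hx1 hx2
    rw [hx1, Finset.sum_congr rfl hx2]
    simp
  refine ⟨fun j => ψ j, fun j => e j, ?_, ?_⟩
  · refine ContinuousLinearMap.opNorm_le_bound _ zero_le_one fun f => ?_
    rw [one_mul, Lp.norm_def, Lp.norm_def]
    refine ENNReal.toReal_mono (Lp.eLpNorm_ne_top f) ?_
    rw [eLpNorm_congr_ae (hPae f), eLpNorm_eq_lintegral_rpow_enorm_toReal hp0 hp',
      eLpNorm_eq_lintegral_rpow_enorm_toReal hp0 hp']
    refine ENNReal.rpow_le_rpow ?_ (by positivity)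
    have h1 : ∫⁻ x, ‖ψ (s x) f‖ₑ ^ p.toReal ∂μ =
        ∑ v ∈ s.range, ‖ψ v f‖ₑ ^ p.toReal * μ (s ⁻¹' {v}) := by
      rw [← SimpleFunc.map_lintegral (fun v => ‖ψ v f‖ₑ ^ p.toReal) s,
        ← SimpleFunc.lintegral_eq_lintegral]
      rfl
    rw [h1]
    calc _ ≤ ∑ v ∈ s.range, ∫⁻ x in s ⁻¹' {v}, ‖f x‖ₑ ^ p.toReal ∂μ := by
          refine Finset.sum_le_sum fun v _ => ?_
          by_cases hv : v = 0
          · simp [hv, hψ0, hpr]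
          · rw [hψ v hv]
            exact average_rpow_le hp' (hfin v hv) f
      _ = ∫⁻ x in ⋃ v ∈ s.range, s ⁻¹' {v}, ‖f x‖ₑ ^ p.toReal ∂μ := by
          rw [lintegral_biUnion_finset _ fun v _ => hmeas v]
          intro v _ w _ hvw
          exact Disjoint.preimage _ (by simpa using hvw)
      _ ≤ _ := setLIntegral_le_lintegral _ _
  · intro u hu f hf
    refine Lp.ext ?_
    have h0 : ∀ v ∈ s.range, ∀ᵐ x ∂μ, s x = v → ψ v f = u v := by
      intro v _
      by_cases hv : v = 0
      · simp [hv, hψ0, hu]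
      by_cases hz : μ (s ⁻¹' {v}) = 0
      · have : ∀ᵐ x ∂μ, x ∉ s ⁻¹' {v} := measure_eq_zero_iff_ae_notMem.1 hz
        filter_upwards [this] with x hx hxv
        exact absurd hxv (by simpa using hx)
      · refine Eventually.of_forall fun x _ => ?_
        rw [hψ v hv]
        have : ∫ x in s ⁻¹' {v}, f x ∂μ = ∫ x in s ⁻¹' {v}, u v ∂μ := by
          refine setIntegral_congr_ae (hmeas v) ?_
          filter_upwards [hf] with x hx hxv
          rw [hx]
          rw [show s x = v from hxv]
        rw [this, setIntegral_const, Measure.real, Complex.real_smul, ← mul_assoc,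
          inv_mul_cancel₀, one_mul]
        simpa using ENNReal.toReal_ne_zero.2 ⟨hz, hfin v hv⟩
    filter_upwards [hPae f, hf, (Filter.eventually_all_finset s.range).2 h0] with x h1 h2 h3
    rw [h1, h2]
    exact h3 (s x) (s.mem_range_self x) rfl

/-- `L^p` has the approximation property, so that the trace of a nuclear operator on `L^p` is well
defined. -/
instance traceDuality_lp [hp' : Fact (p ≠ ∞)] : TraceDuality (lpDuality μ p q) where
  norm_le := norm_lpDuality_le
  trace_zero := by
    refine trace_zero_of_approx _ norm_lpDuality_le fun f N ε hε => ?_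
    have hF : MemLp (fun x (n : Fin N) => f n x) p μ := MemLp.of_eval fun n => Lp.memLp (f n)
    obtain ⟨s, hs, hsm⟩ := hF.exists_simpleFunc_eLpNorm_sub_lt hp'.out
      (ε := ENNReal.ofReal (ε / 2)) (by simpa using hε)
    obtain ⟨ψ, e, hP, hPs⟩ := exists_averaging q hp'.out s hsm
    refine ⟨Fin s.range.card, inferInstance, fun j => ψ (s.range.equivFin.symm j),
      fun j => e (s.range.equivFin.symm j), ?_⟩
    rw [Equiv.sum_comp s.range.equivFin.symm (fun j => (ψ j).smulRight (e j))]
    set P := ∑ j, (ψ j).smulRight (e j)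
    refine ⟨hP, fun n hn => ?_⟩
    have hsn : MemLp (fun x => s x ⟨n, hn⟩) p μ := hsm.eval ⟨n, hn⟩
    have hfix : P hsn.toLp = hsn.toLp :=
      hPs (fun v => v ⟨n, hn⟩) rfl _ hsn.coeFn_toLp
    have hdist : ‖f n - hsn.toLp‖ ≤ ε / 2 := by
      rw [Lp.norm_def]
      refine ENNReal.toReal_le_of_le_ofReal (by positivity) (le_trans ?_ hs.le)
      refine eLpNorm_mono_ae ?_
      filter_upwards [Lp.coeFn_sub (f n) hsn.toLp, hsn.coeFn_toLp] with x h1 h2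
      rw [h1, Pi.sub_apply, h2]
      exact norm_le_pi_norm (fun m : Fin N => f m x - s x m) ⟨n, hn⟩
    calc ‖f n - P (f n)‖ = ‖(f n - hsn.toLp) - P (f n - hsn.toLp)‖ := by
          rw [map_sub, hfix]; congr 1; abel
      _ ≤ ‖f n - hsn.toLp‖ + ‖P (f n - hsn.toLp)‖ := norm_sub_le _ _
      _ ≤ ‖f n - hsn.toLp‖ + 1 * ‖f n - hsn.toLp‖ := by gcongr; exact P.le_of_opNorm_le hP _
      _ ≤ ε := by linarith

end Lp

namespace Nuclear

variable {E F : Type*} [NormedAddCommGroup E] [NormedSpace ℂ E]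
  [NormedAddCommGroup F] [NormedSpace ℂ F] {B : E →L[ℂ] F →L[ℂ] ℂ}

theorem continuous_rankOne {Y : Type*} [TopologicalSpace Y] {a : Y → E} {b : Y → F}
    (ha : Continuous a) (hb : Continuous b) :
    Continuous fun y => (rankOne (a y) (b y) : Nuclear B) := by
  let R : E →L[ℂ] F →L[ℂ] Nuclear B := LinearMap.mkContinuous₂
    (LinearMap.mk₂ ℂ (fun f g => rankOne f g)
      (fun f f' g => toOp_injective (by ext x; simp))
      (fun c f g => toOp_injective (ContinuousLinearMap.ext fun x => smul_comm _ _ _))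
      (fun f g g' => toOp_injective (by ext x; simp [add_smul]))
      (fun c f g => toOp_injective (by ext x; simp [mul_smul]))) 1
    (fun f g => by simpa using norm_rankOne_le f g)
  exact R.continuous₂.comp (ha.prodMk hb)

end Nuclear

section Measurability

theorem aestronglyMeasurable_smul_continuous {G : Type*} [TopologicalSpace G] [R1Space G]
    [MeasurableSpace G] [BorelSpace G] {μ : Measure G} [μ.InnerRegularCompactLTTop]
    {Y : Type*} [NormedAddCommGroup Y] [NormedSpace ℂ Y]
    {w : G → ℂ} (hw : Integrable w μ) {φ : G → Y} (hφ : Continuous φ) :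
    AEStronglyMeasurable (fun t => w t • φ t) μ := by
  have hdense : ∀ n : ℕ, ∃ u : G → ℂ, eLpNorm (w - u) 1 μ ≤ ((n : ℝ≥0∞) + 1)⁻¹ ∧
      AEStronglyMeasurable u μ ∧ AEStronglyMeasurable (fun t => u t • φ t) μ := by
    intro n
    refine (memLp_one_iff_integrable.2 hw).induction_dense ENNReal.one_ne_top
      (fun u => AEStronglyMeasurable u μ ∧ AEStronglyMeasurable (fun t => u t • φ t) μ)
      ?_ ?_ (fun u hu => hu.1) (by simp)
    · intro c t ht htμ ε hε
      obtain ⟨η, ηpos, hη⟩ := exists_eLpNorm_indicator_le (μ := μ) ENNReal.one_ne_top c hε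
      obtain ⟨s, st, s_compact, s_closed, μs⟩ :=
        ht.exists_isCompact_isClosed_sdiff_lt htμ.ne (ENNReal.coe_pos.2 ηpos).ne'
      refine ⟨s.indicator fun _ => c, ?_,
        aestronglyMeasurable_const.indicator s_closed.measurableSet, ?_⟩
      · rw [← eLpNorm_neg, neg_sub, ← Set.indicator_sdiff st]
        exact hη _ μs.le
      · have h1 : (fun x => s.indicator (fun _ => c) x • φ x) = s.indicator fun x => c • φ x := by
          ext x
          by_cases hx : x ∈ s <;> simp [hx]
        rw [h1, aestronglyMeasurable_indicator_iff s_closed.measurableSet]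
        exact (continuous_const.smul hφ).continuousOn.aestronglyMeasurable_of_isCompact s_compact
          s_closed.measurableSet
    · rintro u v ⟨hu, hu'⟩ ⟨hv, hv'⟩
      refine ⟨hu.add hv, ?_⟩
      simpa only [Pi.add_apply, add_smul] using! hu'.add hv'
  choose u hle hmem hsm using hdense
  have ht : Tendsto (fun n => eLpNorm (u n - w) 1 μ) atTop (𝓝 0) := by
    refine tendsto_of_tendsto_of_tendsto_of_le_of_le tendsto_const_nhds
      (?_ : Tendsto (fun n : ℕ => ((n : ℝ≥0∞) + 1)⁻¹) atTop (𝓝 0)) (fun _ => zero_le)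
      (fun n => ?_)
    · have := (tendsto_add_atTop_iff_nat 1).2 ENNReal.tendsto_inv_nat_nhds_zero
      simpa using this
    · rw [eLpNorm_sub_comm]; exact hle n
  obtain ⟨ns, -, hns⟩ := (tendstoInMeasure_of_tendsto_eLpNorm one_ne_zero
    hmem hw.1 ht).exists_seq_tendsto_ae
  refine aestronglyMeasurable_of_tendsto_ae atTop (f := fun n t => u (ns n) t • φ t)
    (fun n => hsm _) ?_
  filter_upwards [hns] with t h
  exact h.smul_const _

theorem integrable_mul_lp {X : Type*} [MeasurableSpace X] {μ : Measure X} {p q : ℝ≥0∞}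
    [Fact (1 ≤ p)] [Fact (1 ≤ q)] [p.HolderConjugate q] (k : Lp ℂ p μ) (l : Lp ℂ q μ) :
    Integrable (fun t => k t * l t) μ ∧ ∫ t, ‖k t * l t‖ ∂μ ≤ ‖k‖ * ‖l‖ := by
  have h : ⇑((ContinuousLinearMap.mul ℂ ℂ).holder 1 k l) =ᵐ[μ] fun t => k t * l t :=
    (ContinuousLinearMap.mul ℂ ℂ).coeFn_holder (r := 1) k l
  have h0 := (ContinuousLinearMap.mul ℂ ℂ).norm_holder_apply_apply_le (r := 1) k l
  refine ⟨(L1.integrable_coeFn _).congr h, ?_⟩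
  rw [L1.norm_eq_integral_norm] at h0
  rw [← integral_congr_ae (h.mono fun t ht => congrArg norm ht)]
  refine h0.trans ?_
  calc _ ≤ 1 * ‖k‖ * ‖l‖ := by gcongr; exact ContinuousLinearMap.opNorm_mul_le ℂ ℂ
    _ = _ := by ring

end Measurability

section Group

open Nuclear

variable {G : Type*} [Group G] [TopologicalSpace G] [IsTopologicalGroup G]
  [LocallyCompactSpace G] [MeasurableSpace G] [BorelSpace G] {μ : Measure G} [μ.IsHaarMeasure]
  {p q : ℝ≥0∞} [Fact (1 ≤ p)] [Fact (1 ≤ q)]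

/-- The left translation `(L_t f)(s) = f (t s)` on `L^p(G)`. -/
def transl (t : G) : Lp ℂ p μ →L[ℂ] Lp ℂ p μ :=
  (Lp.compMeasurePreservingₗᵢ ℂ (t * ·) (measurePreserving_mul_left μ t)).toContinuousLinearMap

theorem transl_eq_smul (t : G) (f : Lp ℂ p μ) : transl t f = DomMulAct.mk t • f := rfl

theorem coeFn_transl (t : G) (f : Lp ℂ p μ) : ⇑(transl t f) =ᵐ[μ] fun s => f (t * s) :=
  Lp.coeFn_compMeasurePreserving f (measurePreserving_mul_left μ t)

theorem norm_transl (t : G) (f : Lp ℂ p μ) : ‖transl t f‖ = ‖f‖ :=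
  (Lp.compMeasurePreservingₗᵢ ℂ (t * ·) (measurePreserving_mul_left μ t)).norm_map f

theorem transl_transl (s t : G) (f : Lp ℂ p μ) : transl s (transl t f) = transl (t * s) f := by
  simp only [transl_eq_smul, smul_smul, DomMulAct.mk_mul]

theorem transl_one (f : Lp ℂ p μ) : transl 1 f = f := by
  simp [transl_eq_smul]

theorem opNorm_transl_le (t : G) : ‖(transl t : Lp ℂ p μ →L[ℂ] Lp ℂ p μ)‖ ≤ 1 :=
  ContinuousLinearMap.opNorm_le_bound _ zero_le_one fun f => by rw [norm_transl, one_mul]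

theorem transl_adjoint [p.HolderConjugate q] (t : G) (f : Lp ℂ p μ) (g : Lp ℂ q μ) :
    lpDuality μ p q (transl t f) g = lpDuality μ p q f (transl t⁻¹ g) := by
  rw [lpDuality_apply, lpDuality_apply,
    ← integral_mul_left_eq_self (fun x => f x * transl t⁻¹ g x) t]
  refine integral_congr_ae ?_
  have h2 := (measurePreserving_mul_left μ t).quasiMeasurePreserving.ae (coeFn_transl t⁻¹ g)
  filter_upwards [coeFn_transl t f, h2] with x h1 h2
  rw [h1, h2]
  simp

theorem continuous_transl [μ.Regular] [Fact (p ≠ ∞)] {Y : Type*} [TopologicalSpace Y] {a : Y → G}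
    {b : Y → Lp ℂ p μ} (ha : Continuous a) (hb : Continuous b) :
    Continuous fun y => transl (a y) (b y) :=
  (DomMulAct.continuous_mk.comp ha).smul hb

/-- The multiplication operator `M_h f = h f` on `L^p(G)`, for `h` in `L^∞(G)`. -/
def mulOp (h : Lp ℂ ∞ μ) : Lp ℂ p μ →L[ℂ] Lp ℂ p μ :=
  (ContinuousLinearMap.mul ℂ ℂ).holderL μ ∞ p p h

theorem coeFn_mulOp (h : Lp ℂ ∞ μ) (f : Lp ℂ p μ) : ⇑(mulOp h f) =ᵐ[μ] fun x => h x * f x :=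
  (ContinuousLinearMap.mul ℂ ℂ).coeFn_holder h f

variable [p.HolderConjugate q] [μ.Regular] [Fact (p ≠ ∞)]

/-- The function `t ↦ ⟨ρ, L_t T L_{t⁻¹}⟩`. -/
def coef (T : Lp ℂ p μ →L[ℂ] Lp ℂ p μ) (ρ : Nuclear (lpDuality μ p q)) (t : G) : ℂ :=
  pair _ (transl t ∘L T ∘L transl t⁻¹) ρ

theorem hasSum_coef (T : Lp ℂ p μ →L[ℂ] Lp ℂ p μ) {ρ : Nuclear (lpDuality μ p q)}
    {f : ℕ → Lp ℂ p μ} {g : ℕ → Lp ℂ q μ} (h : IsNuclearRep (lpDuality μ p q) (toOp _ ρ) f g)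
    (t : G) :
    HasSum (fun n => lpDuality μ p q (transl t (T (transl t⁻¹ (f n)))) (g n)) (coef T ρ t) := by
  have := hasSum_pair h (transl t ∘L T ∘L transl t⁻¹)
  simpa only [coef, ContinuousLinearMap.comp_apply] using this

theorem continuous_coef (T : Lp ℂ p μ →L[ℂ] Lp ℂ p μ) (ρ : Nuclear (lpDuality μ p q)) :
    Continuous (coef T ρ) := by
  obtain ⟨f, g, h⟩ := ρ.exists_rep
  have : coef T ρ = fun t =>
      ∑' n, lpDuality μ p q (transl t (T (transl t⁻¹ (f n)))) (g n) :=
    funext fun t => (hasSum_coef T h t).tsum_eq.symm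
  rw [this]
  refine continuous_tsum (fun n => ?_) (h.summable.mul_left ‖T‖) fun n t => ?_
  · exact ((lpDuality μ p q).flip (g n)).continuous.comp
      (continuous_transl continuous_id
        (T.continuous.comp (continuous_transl continuous_inv continuous_const)))
  · refine (norm_pairing_le _ _ _).trans ?_
    rw [norm_transl, ← mul_assoc]
    gcongr
    refine (T.le_opNorm _).trans ?_
    rw [norm_transl]

theorem norm_coef_le (T : Lp ℂ p μ →L[ℂ] Lp ℂ p μ) (ρ : Nuclear (lpDuality μ p q)) (t : G) :
    ‖coef T ρ t‖ ≤ ‖T‖ * ‖ρ‖ := by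
  refine (norm_pair_le _ _).trans ?_
  gcongr
  refine ContinuousLinearMap.opNorm_le_bound _ (norm_nonneg _) fun f => ?_
  simp only [ContinuousLinearMap.comp_apply, norm_transl]
  refine (T.le_opNorm _).trans ?_
  rw [norm_transl]

theorem memLp_coef (T : Lp ℂ p μ →L[ℂ] Lp ℂ p μ) (ρ : Nuclear (lpDuality μ p q)) :
    MemLp (coef T ρ) ∞ μ :=
  memLp_top_of_bound (continuous_coef T ρ).aestronglyMeasurable (‖T‖ * ‖ρ‖)
    (Eventually.of_forall fun t => norm_coef_le T ρ t)

/-- `T ⊙ ρ = M_h` with `h t = ⟨ρ, L_t T L_{t⁻¹}⟩`. -/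
def odot (T : Lp ℂ p μ →L[ℂ] Lp ℂ p μ) (ρ : Nuclear (lpDuality μ p q)) :
    Lp ℂ p μ →L[ℂ] Lp ℂ p μ :=
  mulOp (memLp_coef T ρ).toLp

theorem coeFn_odot (T : Lp ℂ p μ →L[ℂ] Lp ℂ p μ) (ρ : Nuclear (lpDuality μ p q))
    (f : Lp ℂ p μ) : ⇑(odot T ρ f) =ᵐ[μ] fun t => coef T ρ t * f t := by
  filter_upwards [coeFn_mulOp (memLp_coef T ρ).toLp f, (memLp_coef T ρ).coeFn_toLp] with t h1 h2
  rw [odot, h1, h2]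

theorem odot_add (T : Lp ℂ p μ →L[ℂ] Lp ℂ p μ) (ρ τ : Nuclear (lpDuality μ p q)) :
    odot T (ρ + τ) = odot T ρ + odot T τ := by
  refine ContinuousLinearMap.ext fun f => Lp.ext ?_
  filter_upwards [coeFn_odot T (ρ + τ) f, coeFn_odot T ρ f, coeFn_odot T τ f,
    Lp.coeFn_add (odot T ρ f) (odot T τ f)] with t h1 h2 h3 h4
  rw [h1, _root_.add_apply, h4, Pi.add_apply, h2, h3]
  simp [coef, add_mul]

theorem odot_smul (c : ℂ) (T : Lp ℂ p μ →L[ℂ] Lp ℂ p μ) (ρ : Nuclear (lpDuality μ p q)) :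
    odot T (c • ρ) = c • odot T ρ := by
  refine ContinuousLinearMap.ext fun f => Lp.ext ?_
  filter_upwards [coeFn_odot T (c • ρ) f, coeFn_odot T ρ f,
    Lp.coeFn_smul c (odot T ρ f)] with t h1 h2 h4
  rw [h1, _root_.smul_apply, h4, Pi.smul_apply, h2]
  simp [coef, mul_assoc]

theorem odot_id (ρ : Nuclear (lpDuality μ p q)) :
    odot (ContinuousLinearMap.id ℂ _) ρ = Tr _ ρ • ContinuousLinearMap.id ℂ _ := by
  refine ContinuousLinearMap.ext fun f => Lp.ext ?_
  filter_upwards [coeFn_odot (ContinuousLinearMap.id ℂ _) ρ f, Lp.coeFn_smul (Tr _ ρ) f]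
    with t h1 h2
  rw [h1, _root_.smul_apply, ContinuousLinearMap.id_apply, h2, Pi.smul_apply, smul_eq_mul, coef,
    ← pair_id]
  congr 3
  ext1 f
  simp [transl_transl, transl_one]

/-- `L_{t⁻¹} ρ L_t`. -/
def conj (t : G) (ρ : Nuclear (lpDuality μ p q)) : Nuclear (lpDuality μ p q) :=
  mk ((ρ.exists_rep.choose_spec.choose_spec.comp_left (transl t⁻¹)).comp_right (transl t)
    (transl t⁻¹) (transl_adjoint t))

theorem conj_rep (t : G) {ρ : Nuclear (lpDuality μ p q)} {f : ℕ → Lp ℂ p μ} {g : ℕ → Lp ℂ q μ}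
    (h : IsNuclearRep (lpDuality μ p q) (toOp _ ρ) f g) :
    IsNuclearRep (lpDuality μ p q) (toOp _ (conj t ρ)) (fun n => transl t⁻¹ (f n))
      (fun n => transl t⁻¹ (g n)) :=
  (h.comp_left (transl t⁻¹)).comp_right (transl t) (transl t⁻¹) (transl_adjoint t)

theorem norm_conj_le (t : G) (ρ : Nuclear (lpDuality μ p q)) : ‖conj t ρ‖ ≤ ‖ρ‖ := by
  refine le_of_forall_gt_imp_ge_of_dense fun c hc => ?_
  obtain ⟨f, g, h, hlt⟩ := ρ.exists_rep_lt hc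
  refine (norm_le_of_rep (conj_rep t h)).trans ?_
  simp only [norm_transl]
  exact hlt.le

theorem pair_conj (T : Lp ℂ p μ →L[ℂ] Lp ℂ p μ) (t : G) (ρ : Nuclear (lpDuality μ p q)) :
    pair _ T (conj t ρ) = coef T ρ t := by
  obtain ⟨f, g, h⟩ := ρ.exists_rep
  refine (hasSum_pair (conj_rep t h) T).unique ?_
  simpa only [transl_adjoint] using hasSum_coef T h t

theorem continuous_conj [Fact (q ≠ ∞)] (ρ : Nuclear (lpDuality μ p q)) :
    Continuous fun t : G => conj t ρ := by
  obtain ⟨f, g, h⟩ := ρ.exists_rep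
  have : (fun t : G => conj t ρ) = fun t =>
      ∑' n, rankOne (transl t⁻¹ (f n)) (transl t⁻¹ (g n)) :=
    funext fun t => (hasSum_rankOne (conj_rep t h)).tsum_eq.symm
  rw [this]
  refine continuous_tsum (fun n => ?_) h.summable fun n t => ?_
  · exact continuous_rankOne (continuous_transl continuous_inv continuous_const)
      (continuous_transl continuous_inv continuous_const)
  · refine (norm_rankOne_le _ _).trans ?_
    rw [norm_transl, norm_transl]

theorem exists_conv_of_rep [Fact (q ≠ ∞)] (ρ τ : Nuclear (lpDuality μ p q)) {k : ℕ → Lp ℂ p μ}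
    {l : ℕ → Lp ℂ q μ} (h : IsNuclearRep (lpDuality μ p q) (toOp _ τ) k l) :
    ∃ σ : Nuclear (lpDuality μ p q), (∀ T, pair _ T σ = pair _ (odot T ρ) τ) ∧
      ‖σ‖ ≤ ‖ρ‖ * ∑' n, ‖k n‖ * ‖l n‖ := by
  have hint : ∀ n, Integrable (fun t => (k n t * l n t) • conj t ρ) μ := by
    intro n
    refine Integrable.mono' ((integrable_mul_lp (k n) (l n)).1.norm.mul_const ‖ρ‖)
      (aestronglyMeasurable_smul_continuous (integrable_mul_lp (k n) (l n)).1
        (continuous_conj ρ)) (Eventually.of_forall fun t => ?_)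
    rw [norm_smul]
    gcongr
    exact norm_conj_le t ρ
  have hbound : ∀ n, ‖∫ t, (k n t * l n t) • conj t ρ ∂μ‖ ≤ ‖ρ‖ * (‖k n‖ * ‖l n‖) := by
    intro n
    calc _ ≤ ∫ t, ‖k n t * l n t‖ * ‖ρ‖ ∂μ := by
          refine norm_integral_le_of_norm_le
            ((integrable_mul_lp (k n) (l n)).1.norm.mul_const ‖ρ‖)
            (Eventually.of_forall fun t => ?_)
          rw [norm_smul]
          gcongr
          exact norm_conj_le t ρ
      _ = (∫ t, ‖k n t * l n t‖ ∂μ) * ‖ρ‖ := integral_mul_const _ _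
      _ ≤ (‖k n‖ * ‖l n‖) * ‖ρ‖ := by gcongr; exact (integrable_mul_lp (k n) (l n)).2
      _ = _ := by ring
  have hsum := Summable.of_norm_bounded (h.summable.mul_left ‖ρ‖) hbound
  refine ⟨∑' n, ∫ t, (k n t * l n t) • conj t ρ ∂μ, fun T => ?_, ?_⟩
  · have h1 := hsum.hasSum.mapL (pair _ T)
    refine h1.unique ?_
    convert hasSum_pair h (odot T ρ) using 2 with n
    rw [← ContinuousLinearMap.integral_comp_comm _ (hint n), lpDuality_apply]
    refine integral_congr_ae ?_
    filter_upwards [coeFn_odot T ρ (k n)] with t ht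
    rw [ht, map_smul, pair_conj, smul_eq_mul]
    ring
  · rw [← tsum_mul_left]
    exact tsum_of_norm_bounded (h.summable.mul_left ‖ρ‖).hasSum hbound

theorem exists_conv [Fact (q ≠ ∞)] (ρ τ : Nuclear (lpDuality μ p q)) :
    ∃ σ : Nuclear (lpDuality μ p q), ∀ T, pair _ T σ = pair _ (odot T ρ) τ := by
  obtain ⟨k, l, h⟩ := τ.exists_rep
  obtain ⟨σ, hσ, -⟩ := exists_conv_of_rep ρ τ h
  exact ⟨σ, hσ⟩

/-- The convolution `ρ * τ` of nuclear operators on `L^p(G)`: the unique nuclear operator with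
`⟨T, ρ * τ⟩ = ⟨T ⊙ ρ, τ⟩` for all bounded operators `T`. -/
def conv [Fact (q ≠ ∞)] (ρ τ : Nuclear (lpDuality μ p q)) : Nuclear (lpDuality μ p q) :=
  (exists_conv ρ τ).choose

variable [Fact (q ≠ ∞)]

theorem pair_conv (T : Lp ℂ p μ →L[ℂ] Lp ℂ p μ) (ρ τ : Nuclear (lpDuality μ p q)) :
    pair _ T (conv ρ τ) = pair _ (odot T ρ) τ :=
  (exists_conv ρ τ).choose_spec T

theorem norm_conv_le (ρ τ : Nuclear (lpDuality μ p q)) : ‖conv ρ τ‖ ≤ ‖ρ‖ * ‖τ‖ := by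
  refine le_of_forall_pos_le_add fun ε hε => ?_
  obtain ⟨k, l, h, hlt⟩ := τ.exists_rep_lt
    (lt_add_of_pos_right ‖τ‖ (by positivity : 0 < ε / (‖ρ‖ + 1)))
  obtain ⟨σ, hσ, hle⟩ := exists_conv_of_rep ρ τ h
  have : conv ρ τ = σ := ext_pair fun T => by rw [pair_conv, hσ]
  rw [this]
  calc _ ≤ _ := hle
    _ ≤ ‖ρ‖ * (‖τ‖ + ε / (‖ρ‖ + 1)) := by gcongr
    _ = ‖ρ‖ * ‖τ‖ + ε * (‖ρ‖ / (‖ρ‖ + 1)) := by ring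
    _ ≤ ‖ρ‖ * ‖τ‖ + ε * 1 := by
      gcongr
      rw [div_le_one (by positivity)]; linarith
    _ = _ := by ring

theorem odot_conv (T : Lp ℂ p μ →L[ℂ] Lp ℂ p μ) (ρ τ : Nuclear (lpDuality μ p q)) :
    odot T (conv ρ τ) = odot (odot T ρ) τ := by
  have key : ∀ t, coef T (conv ρ τ) t = coef (odot T ρ) τ t := by
    intro t
    rw [coef, pair_conv, coef]
    congr 2
    refine ContinuousLinearMap.ext fun f => Lp.ext ?_
    have h2 := (measurePreserving_mul_left μ t).quasiMeasurePreserving.ae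
      (coeFn_odot T ρ (transl t⁻¹ f))
    have h3 := (measurePreserving_mul_left μ t).quasiMeasurePreserving.ae (coeFn_transl t⁻¹ f)
    filter_upwards [coeFn_odot (transl t ∘L T ∘L transl t⁻¹) ρ f,
      coeFn_transl t (odot T ρ (transl t⁻¹ f)), h2, h3] with s h1 h2 h3 h4
    simp only [ContinuousLinearMap.comp_apply]
    rw [h1, h2, h3, h4, inv_mul_cancel_left]
    congr 1
    rw [coef, coef]
    congr 2
    ext1 f
    simp [transl_transl]
  refine ContinuousLinearMap.ext fun f => Lp.ext ?_
  filter_upwards [coeFn_odot T (conv ρ τ) f, coeFn_odot (odot T ρ) τ f] with t h1 h2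
  rw [h1, h2, key]

/-- The convolution algebra of nuclear operators on `L^p(G)`: the Banach space of nuclear operators
with the nuclear norm and the convolution product. -/
instance : NonUnitalNormedRing (Nuclear (lpDuality μ p q)) where
  __ := (inferInstance : NormedAddCommGroup (Nuclear (lpDuality μ p q)))
  mul := conv
  left_distrib ρ τ υ := ext_pair fun T => by
    change pair _ T (conv _ _) = pair _ T (conv _ _ + conv _ _)
    simp [pair_conv]
  right_distrib ρ τ υ := ext_pair fun T => by
    change pair _ T (conv _ _) = pair _ T (conv _ _ + conv _ _)
    simp [pair_conv, odot_add]
  zero_mul τ := ext_pair fun T => by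
    change pair _ T (conv _ _) = pair _ T _
    have : odot T (0 : Nuclear (lpDuality μ p q)) = 0 := by simpa using odot_smul 0 T 0
    simp [pair_conv, this]
  mul_zero τ := ext_pair fun T => by
    change pair _ T (conv _ _) = pair _ T _
    simp [pair_conv]
  mul_assoc ρ τ υ := ext_pair fun T => by
    change pair _ T (conv (conv _ _) _) = pair _ T (conv _ (conv _ _))
    simp [pair_conv, odot_conv]
  norm_mul_le := norm_conv_le

theorem mul_eq_conv (ρ τ : Nuclear (lpDuality μ p q)) : ρ * τ = conv ρ τ := rfl

instance : IsScalarTower ℂ (Nuclear (lpDuality μ p q)) (Nuclear (lpDuality μ p q)) :=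
  ⟨fun c ρ τ => ext_pair fun T => by
    simp [mul_eq_conv, pair_conv, odot_smul]⟩

instance : SMulCommClass ℂ (Nuclear (lpDuality μ p q)) (Nuclear (lpDuality μ p q)) :=
  ⟨fun c ρ τ => ext_pair fun T => by
    simp [mul_eq_conv, pair_conv]⟩

theorem Tr_mul (ρ τ : Nuclear (lpDuality μ p q)) : Tr _ (ρ * τ) = Tr _ ρ * Tr _ τ := by
  rw [← pair_id, mul_eq_conv, pair_conv, odot_id]
  simp [pair_id]

end Group

/-! ### Right Banach modules -/

section Modules

universe u v w

/-- A structure of right Banach module over the Banach algebra `A` on the Banach space `X`: a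
jointly continuous bilinear right action of `A` on `X`. Neither `A` nor the action is required to be
unital. -/
structure RightBanachModule (A : Type u) [NonUnitalNormedRing A] [NormedSpace ℂ A]
    (X : Type v) [NormedAddCommGroup X] [NormedSpace ℂ X] where
  act : X →L[ℂ] A →L[ℂ] X
  act_mul : ∀ x a b, act x (a * b) = act (act x a) b

namespace RightBanachModule

variable {A : Type u} [NonUnitalNormedRing A] [NormedSpace ℂ A]

/-- The space of morphisms of right Banach modules: continuous linear maps commuting with the
action. -/
def Hom {X : Type v} [NormedAddCommGroup X] [NormedSpace ℂ X] {Y : Type w} [NormedAddCommGroup Y]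
    [NormedSpace ℂ Y] (MX : RightBanachModule A X) (MY : RightBanachModule A Y) :
    Submodule ℂ (X →L[ℂ] Y) where
  carrier := {φ | ∀ x a, φ (MX.act x a) = MY.act (φ x) a}
  zero_mem' := fun x a => by simp
  add_mem' := fun hφ hψ x a => by simp [hφ x a, hψ x a]
  smul_mem' := fun c φ hφ x a => by simp [hφ x a]

/-- Composition with a morphism, as a map `h_A(Y, X) → h_A(Y, X')`. -/
def postcomp {X X' : Type v} [NormedAddCommGroup X] [NormedSpace ℂ X] [NormedAddCommGroup X']
    [NormedSpace ℂ X'] {Y : Type w} [NormedAddCommGroup Y] [NormedSpace ℂ Y]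
    {MX : RightBanachModule A X} {MX' : RightBanachModule A X'} (MY : RightBanachModule A Y)
    (φ : Hom MX MX') (ψ : Hom MY MX) : Hom MY MX' :=
  ⟨φ.1 ∘L ψ.1, fun y a => by
    rw [ContinuousLinearMap.comp_apply, ψ.2, φ.2, ContinuousLinearMap.comp_apply]⟩

/-- The sequence `0 → X₁ → X₂ → X₃ → 0` given by `i` and `j` splits as a sequence of Banach
spaces. -/
def SplitsAsBanach {X₁ X₂ X₃ : Type v} [NormedAddCommGroup X₁] [NormedSpace ℂ X₁]
    [NormedAddCommGroup X₂] [NormedSpace ℂ X₂] [NormedAddCommGroup X₃] [NormedSpace ℂ X₃]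
    (i : X₁ →L[ℂ] X₂) (j : X₂ →L[ℂ] X₃) : Prop :=
  ∃ (r : X₂ →L[ℂ] X₁) (s : X₃ →L[ℂ] X₂), r ∘L i = ContinuousLinearMap.id ℂ X₁ ∧
    j ∘L s = ContinuousLinearMap.id ℂ X₃ ∧ i ∘L r + s ∘L j = ContinuousLinearMap.id ℂ X₂

/-- A right Banach module `Y` is projective if for each admissible sequence
`0 → X₁ → X₂ → X₃ → 0` of right Banach modules (that is, one which splits as a sequence of Banach
spaces) the sequence `0 → h_A(Y, X₁) → h_A(Y, X₂) → h_A(Y, X₃) → 0` is exact. -/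
def IsProjective {Y : Type w} [NormedAddCommGroup Y] [NormedSpace ℂ Y]
    (MY : RightBanachModule A Y) : Prop :=
  ∀ (X₁ X₂ X₃ : Type u) [NormedAddCommGroup X₁] [NormedSpace ℂ X₁] [CompleteSpace X₁]
    [NormedAddCommGroup X₂] [NormedSpace ℂ X₂] [CompleteSpace X₂]
    [NormedAddCommGroup X₃] [NormedSpace ℂ X₃] [CompleteSpace X₃]
    (M₁ : RightBanachModule A X₁) (M₂ : RightBanachModule A X₂) (M₃ : RightBanachModule A X₃)
    (i : Hom M₁ M₂) (j : Hom M₂ M₃), SplitsAsBanach i.1 j.1 →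
      Function.Injective (postcomp MY i) ∧ Function.Exact (postcomp MY i) (postcomp MY j) ∧
        Function.Surjective (postcomp MY j)

variable (A) in
/-- The algebra `A` as a right module over itself. -/
def self [IsScalarTower ℂ A A] [SMulCommClass ℂ A A] : RightBanachModule A A where
  act := ContinuousLinearMap.mul ℂ A
  act_mul x a b := by simp [mul_assoc]

end RightBanachModule

end Modules

/-! ### The algebra `𝒩^p(G)` and its trace module -/

section Main

open Nuclear

/-- The conjugate exponent `q`, with `1/p + 1/q = 1`. -/
def conjExp (p : ℝ≥0∞) : ℝ≥0∞ := (1 - p⁻¹)⁻¹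

variable {p : ℝ≥0∞}

instance [h : Fact (1 < p)] : Fact (1 ≤ p) := ⟨h.out.le⟩

instance [h : Fact (1 < p)] : p.HolderConjugate (conjExp p) where
  inv_add_inv_eq_inv := by
    rw [conjExp, inv_inv, inv_one]
    exact add_tsub_cancel_of_le (ENNReal.inv_le_one.2 h.out.le)

instance [Fact (1 < p)] : Fact (1 ≤ conjExp p) := ⟨ENNReal.HolderConjugate.one_le _ p⟩

instance [h : Fact (1 < p)] : Fact (conjExp p ≠ ∞) :=
  ⟨((ENNReal.HolderConjugate.lt_top_iff_one_lt (conjExp p) p).2 h.out).ne⟩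

variable {G : Type*} [Group G] [TopologicalSpace G] [IsTopologicalGroup G]
  [LocallyCompactSpace G] [MeasurableSpace G] [BorelSpace G]
  (p) [Fact (1 < p)] (μ : Measure G)

/-- The Banach algebra `𝒩^p(G)` of nuclear operators on `L^p(G)`, with the nuclear norm and the
convolution product. -/
abbrev NuclearAlgebra : Type _ := Nuclear (lpDuality μ p (conjExp p))

variable [μ.IsHaarMeasure] [μ.Regular] [Fact (p ≠ ∞)]

/-- The right `𝒩^p(G)`-module `ℂ_Tr`: the space `ℂ` with the action `z · a = z Tr a`. -/
def traceModule : RightBanachModule (NuclearAlgebra p μ) ℂ where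
  act := (ContinuousLinearMap.mul ℂ ℂ).bilinearComp (ContinuousLinearMap.id ℂ ℂ)
    (Tr (lpDuality μ p (conjExp p)))
  act_mul x a b := by
    simp [Tr_mul, mul_assoc]

/-- The rank-one operator `1 ⊗ 1 : h ↦ (∫ h dμ) 1`, for a finite measure `μ`. -/
def oneTensorOne [IsFiniteMeasure μ] : NuclearAlgebra p μ :=
  rankOne (Lp.const p μ (1 : ℂ)) (Lp.const (conjExp p) μ (1 : ℂ))

end Main

end NuclearConv

end

noncomputable section

open MeasureTheory Filter Topology
open scoped ENNReal

set_option linter.unusedSectionVars false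

/-! Projectivity of `ℂ_Tr` comes down to one algebraic question: is there an element `e` with `Tr e
= 1` and `e * a = Tr(a) e` for all `a`? Given `e`, a morphism `ψ` from `ℂ_Tr` is lifted by lifting
`ψ 1` linearly and then acting by `e`, which turns the linear lift into a module morphism
(`isProjective_of_mul_eq_smul`). Conversely, projectivity applied to `0 → ker Tr → 𝒩^p(G) → ℂ → 0`
gives a section of `Tr` that is a morphism, and `e` is its value at `1`
(`IsProjective.exists_mul_eq_smul`).

The identity `e * a = Tr(a) e`, tested against a bounded operator `T`, says that multiplication by
the function `t ↦ ⟨L_t T L_{t⁻¹}, e⟩` pairs with every nuclear operator like a scalar. Since this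
function is continuous, it must be constant, so `e` commutes with all translations
(`conj_eq_of_mul_eq_smul`).

On a compact group the constants are translation invariant, so a multiple of `1 ⊗ 1` serves as `e`
(`oneTensorOne_mul`). On a noncompact group the translates `L_t x` tend weakly to zero at infinity.
A nuclear operator turns this into norm convergence, whereas commutation with the isometries `L_t`
keeps `‖e (L_t x)‖` constant. Hence `e = 0` (`eq_zero_of_conj_eq`), against `Tr e = 1`. -/

namespace NuclearConv

namespace RightBanachModule

universe u

/-! ### Projectivity of one-dimensional modules over a Banach algebra. -/

section Projective

variable {A : Type u} [NonUnitalNormedRing A] [NormedSpace ℂ A]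

/-- A one-dimensional module on which `A` acts through `χ` is projective if `A` contains an element
`e` with `χ e = 1` and `e a = χ(a) e` for all `a`. -/
theorem isProjective_of_mul_eq_smul {M : RightBanachModule A ℂ} {χ : A → ℂ}
    (hM : ∀ z a, M.act z a = z * χ a) {e : A} (he : χ e = 1) (hmul : ∀ a, e * a = χ a • e) :
    M.IsProjective := by
  intro X₁ X₂ X₃ _ _ _ _ _ _ _ _ _ M₁ M₂ M₃ i j ⟨r, s, hri, hjs, hsum⟩
  have hri' : ∀ x, r (i.1 x) = x := fun x => congrArg (fun f => f x) hri
  have hjs' : ∀ x, j.1 (s x) = x := fun x => congrArg (fun f => f x) hjs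
  have hsum' : ∀ x, i.1 (r x) + s (j.1 x) = x := fun x => congrArg (fun f => f x) hsum
  have hinj : Function.Injective i.1 := Function.LeftInverse.injective hri'
  have hs : Function.Injective s := Function.LeftInverse.injective hjs'
  -- Injectivity and exactness in the middle follow from the Banach splitting alone; `e` enters only
  -- in the surjectivity.
  refine ⟨fun ψ ψ' h => ?_, fun ψ => ⟨fun h => ?_, ?_⟩, fun ψ => ?_⟩
  · refine Subtype.ext (ContinuousLinearMap.ext fun z => hinj ?_)
    exact congrArg (fun f => f.1 z) h
  · have h' : ∀ z, j.1 (ψ.1 z) = 0 := fun z => congrArg (fun f => f.1 z) h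
    have hir : ∀ z, i.1 (r (ψ.1 z)) = ψ.1 z := fun z => by simpa [h'] using hsum' (ψ.1 z)
    -- The retraction `r` is merely linear. Still `r ∘ ψ` is a morphism, because `i` is an injective
    -- morphism and `i ∘ r ∘ ψ = ψ`.
    refine ⟨⟨r ∘L ψ.1, fun z a => hinj ?_⟩, Subtype.ext (ContinuousLinearMap.ext hir)⟩
    rw [i.2]
    simp only [ContinuousLinearMap.comp_apply, hir]
    exact ψ.2 z a
  · rintro ⟨φ, rfl⟩
    refine Subtype.ext (ContinuousLinearMap.ext fun z => hs ?_)
    change s (j.1 (i.1 (φ.1 z))) = s 0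
    -- Since `r ∘ i = id`, the splitting identity at `i (φ z)` leaves `s (j (i (φ z))) = 0`.
    have := hsum' (i.1 (φ.1 z))
    rw [hri'] at this
    simpa using this
  · have hψ : ∀ z a, M₃.act (ψ.1 z) a = χ a • ψ.1 z := fun z a => by
      rw [← ψ.2, hM, mul_comm, ← smul_eq_mul, map_smul]
    -- Acting by `e` repairs the linear lift `x = s (ψ 1)`: `(x · e) · a = x · (e a) = χ(a) (x ·
    -- e)`, and the image under `j` is unchanged because `ψ 1 · e = χ(e) ψ 1 = ψ 1`.
    refine ⟨⟨ContinuousLinearMap.toSpanSingleton ℂ (M₂.act (s (ψ.1 1)) e), fun z a => ?_⟩,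
      Subtype.ext (ContinuousLinearMap.ext fun z => ?_)⟩
    · simp only [ContinuousLinearMap.toSpanSingleton_apply, hM, map_smul, _root_.smul_apply]
      rw [← M₂.act_mul, hmul, map_smul, smul_smul]
    · change j.1 (z • M₂.act (s (ψ.1 1)) e) = ψ.1 z
      rw [map_smul, j.2, hjs', hψ, he, one_smul, ← map_smul, smul_eq_mul, mul_one]

variable [IsScalarTower ℂ A A] [SMulCommClass ℂ A A]

/-- The kernel of a multiplicative functional, as a right module. -/
def kerModule (χ : A →L[ℂ] ℂ) (hχ : ∀ a b, χ (a * b) = χ a * χ b) :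
    RightBanachModule A (LinearMap.ker χ.toLinearMap) where
  act := LinearMap.mkContinuous₂
    (LinearMap.mk₂ ℂ (fun x a => ⟨(x : A) * a, by
        have hx : χ x = 0 := x.2
        simp [hχ, hx]⟩)
      (fun x y a => Subtype.ext (add_mul _ _ _))
      (fun c x a => Subtype.ext (smul_mul_assoc _ _ _))
      (fun x a b => Subtype.ext (mul_add _ _ _))
      (fun c x a => Subtype.ext (mul_smul_comm _ _ _))) 1
    (fun x a => by
      rw [one_mul]
      exact norm_mul_le (x : A) a)
  act_mul x a b := Subtype.ext (mul_assoc (x : A) a b).symm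

/-- If the one-dimensional module on which `A` acts through `χ ≠ 0` is projective, then `A` contains
an element `e` with `χ e = 1` and `e a = χ(a) e` for all `a`. -/
theorem IsProjective.exists_mul_eq_smul [CompleteSpace A] {M : RightBanachModule A ℂ}
    (hproj : M.IsProjective) {χ : A →L[ℂ] ℂ} (hM : ∀ z a, M.act z a = z * χ a) {a₀ : A}
    (ha₀ : χ a₀ = 1) : ∃ e : A, χ e = 1 ∧ ∀ a, e * a = χ a • e := by
  -- Associativity of the action, evaluated at `1`, forces `χ` to be multiplicative.
  have hχ : ∀ a b, χ (a * b) = χ a * χ b := fun a b => by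
    have := M.act_mul 1 a b
    simpa only [hM, one_mul] using this
  let K := LinearMap.ker χ.toLinearMap
  have : CompleteSpace K := (χ.isClosed_ker).completeSpace_coe
  -- `IsProjective` tests only sequences of modules in the universe of `A`, so the quotient `ℂ` has
  -- to be lifted there.
  let up : ℂ →L[ℂ] ULift.{u} ℂ :=
    (ContinuousLinearEquiv.ulift (R₁ := ℂ) (M₁ := ℂ)).symm.toContinuousLinearMap
  let down : ULift.{u} ℂ →L[ℂ] ℂ :=
    (ContinuousLinearEquiv.ulift (R₁ := ℂ) (M₁ := ℂ)).toContinuousLinearMap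
  have hud : ∀ z, up (down z) = z := fun _ => rfl
  have hdu : ∀ z, down (up z) = z := fun _ => rfl
  let M₃ : RightBanachModule A (ULift.{u} ℂ) :=
    { act := (ContinuousLinearMap.compL ℂ A ℂ (ULift.{u} ℂ) up) ∘L M.act ∘L down
      act_mul := fun x a b => congrArg up (M.act_mul (down x) a b) }
  let i : Hom (kerModule χ hχ) (self A) := ⟨K.subtypeL, fun x a => rfl⟩
  let j : Hom (self A) M₃ := ⟨up ∘L χ, fun x a => congrArg up <| by
    change χ (x * a) = M.act (χ x) a
    rw [hχ, hM]⟩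
  -- The projection onto `ker χ` along `a₀`; it is the retraction that splits the sequence `0 → ker
  -- χ → A → ℂ → 0`.
  let P : A →L[ℂ] A := ContinuousLinearMap.id ℂ A - χ.smulRight a₀
  have hsplit : SplitsAsBanach i.1 j.1 := by
    refine ⟨P.codRestrict K fun a => ?_,
      (ContinuousLinearMap.toSpanSingleton ℂ a₀) ∘L down, ?_, ?_, ?_⟩
    · change χ (a - χ a • a₀) = 0
      simp [ha₀]
    · refine ContinuousLinearMap.ext fun x => Subtype.ext ?_
      change (x : A) - χ x • a₀ = x
      have hx : χ x = 0 := x.2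
      simp [hx]
    · refine ContinuousLinearMap.ext fun z => ?_
      change up (χ (down z • a₀)) = z
      simp [ha₀, hud]
    · refine ContinuousLinearMap.ext fun a => ?_
      change (a - χ a • a₀) + χ a • a₀ = a
      simp
  -- Only surjectivity is needed: lifting the canonical isomorphism `up` through `j` produces a
  -- section of `χ` that is a module morphism.
  obtain ⟨ψ, hψ⟩ := (hproj _ _ _ (kerModule χ hχ) (self A) M₃ i j hsplit).2.2
    ⟨up, fun z a => rfl⟩
  have hψ' : ∀ z, χ (ψ.1 z) = z := fun z => congrArg (fun f => down (f.1 z)) hψ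
  refine ⟨ψ.1 1, hψ' 1, fun a => ?_⟩
  -- As `1 · a = χ(a)` in the one-dimensional module, equivariance at `1` is the identity sought for
  -- `e = ψ 1`.
  have h := ψ.2 1 a
  rw [hM, one_mul] at h
  change ψ.1 (χ a) = ψ.1 1 * a at h
  rw [← h, ← map_smul, smul_eq_mul, mul_one]

end Projective

end RightBanachModule

/-! ### Rank-one operators as test elements for the trace duality. -/

namespace Nuclear

variable {E F : Type*} [NormedAddCommGroup E] [NormedSpace ℂ E]
  [NormedAddCommGroup F] [NormedSpace ℂ F] {B : E →L[ℂ] F →L[ℂ] ℂ} [TraceDuality B]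

theorem Tr_rankOne (f : E) (g : F) : Tr B (rankOne f g) = B f g := by
  have h : IsNuclearRep B (toOp B (rankOne f g)) (fun _ : Unit => f) (fun _ : Unit => g) :=
    ⟨(hasSum_fintype _).summable, fun x => by simp⟩
  simpa using (hasSum_Tr h).unique (hasSum_fintype _)

theorem pair_rankOne (T : E →L[ℂ] E) (f : E) (g : F) : pair B T (rankOne f g) = B (T f) g := by
  rw [← Tr_rankOne (T f) g, pair_apply]
  congr 1
  exact toOp_injective (ContinuousLinearMap.ext fun x => by simp)

end Nuclear

section Lp

variable {X : Type*} [MeasurableSpace X] {μ : Measure X} {p q : ℝ≥0∞} [p.HolderConjugate q]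
  [Fact (1 ≤ p)] [Fact (1 ≤ q)]

theorem lpDuality_indicatorConstLp_one (f : Lp ℂ p μ) {K : Set X} (hK : MeasurableSet K)
    (hfin : μ K ≠ ∞) :
    lpDuality μ p q f (indicatorConstLp q hK hfin 1) = ∫ x in K, f x ∂μ := by
  rw [lpDuality_apply, ← integral_indicator hK]
  refine integral_congr_ae ?_
  filter_upwards [indicatorConstLp_coeFn (p := q) (hs := hK) (hμs := hfin) (c := (1 : ℂ))] with x h
  rw [h]
  by_cases hx : x ∈ K <;> simp [hx]

end Lp

/-! ### Translations at infinity and translation-invariant nuclear operators. -/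

section Translations

open Nuclear

variable {G : Type*} [Group G] [TopologicalSpace G] [IsTopologicalGroup G]
  [LocallyCompactSpace G] [MeasurableSpace G] [BorelSpace G] {μ : Measure G} [μ.IsHaarMeasure]
  {p q : ℝ≥0∞} [Fact (1 ≤ p)] [Fact (1 ≤ q)]

/-- The elements of `L^p` that vanish outside a compact set are dense. -/
theorem exists_compact_support_approx [μ.Regular] (hp : p ≠ ∞) (f : Lp ℂ p μ) {ε : ℝ}
    (hε : 0 < ε) : ∃ u : Lp ℂ p μ, ‖f - u‖ ≤ ε ∧
      ∃ K : Set G, IsCompact K ∧ ∀ᵐ x ∂μ, x ∉ K → u x = 0 := by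
  have hdense : ∃ u : G → ℂ, eLpNorm (⇑f - u) p μ ≤ ENNReal.ofReal ε ∧
      (MemLp u p μ ∧ ∃ K : Set G, IsCompact K ∧ ∀ x ∉ K, u x = 0) := by
    refine (Lp.memLp f).induction_dense hp _ ?_ ?_ (fun u hu => hu.1.1)
      (ENNReal.ofReal_pos.2 hε).ne'
    · intro c t ht htμ ε hε
      -- For `p ≠ ∞` indicators of sets of small measure are small in `L^p`, so by inner regularity
      -- a finite-measure set may be replaced by a closed compact subset.
      obtain ⟨η, ηpos, hη⟩ := exists_eLpNorm_indicator_le (μ := μ) hp c hε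
      obtain ⟨s, st, s_compact, s_closed, μs⟩ :=
        ht.exists_isCompact_isClosed_sdiff_lt htμ.ne (ENNReal.coe_pos.2 ηpos).ne'
      refine ⟨s.indicator fun _ => c, ?_, memLp_indicator_const p s_closed.measurableSet c
        (Or.inr s_compact.measure_lt_top.ne), s, s_compact,
        fun x hx => Set.indicator_of_notMem hx _⟩
      rw [← eLpNorm_neg, neg_sub, ← Set.indicator_sdiff st]
      exact hη _ μs.le
    · rintro u v ⟨hu, K, hK, huK⟩ ⟨hv, K', hK', hvK⟩
      refine ⟨hu.add hv, K ∪ K', hK.union hK', fun x hx => ?_⟩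
      rw [Set.mem_union, not_or] at hx
      simp [huK x hx.1, hvK x hx.2]
  obtain ⟨u, hu, hum, K, hK, huK⟩ := hdense
  refine ⟨hum.toLp, ?_, K, hK, ?_⟩
  · rw [Lp.norm_def]
    refine ENNReal.toReal_le_of_le_ofReal hε.le (le_trans (eLpNorm_congr_ae ?_).le hu)
    filter_upwards [Lp.coeFn_sub f hum.toLp, hum.coeFn_toLp] with x h1 h2
    rw [h1, Pi.sub_apply, h2, Pi.sub_apply]
  · filter_upwards [hum.coeFn_toLp] with x hx hxK
    rw [hx, huK x hxK]

variable [p.HolderConjugate q] [μ.Regular]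

/-- The translations on `L^p(G)` tend weakly to zero at infinity. -/
theorem tendsto_lpDuality_transl_cocompact (hp : p ≠ ∞) (hq : q ≠ ∞) (f : Lp ℂ p μ)
    (g : Lp ℂ q μ) :
    Tendsto (fun t : G => lpDuality μ p q (transl t f) g) (cocompact G) (𝓝 0) := by
  have hB : ∀ (a : Lp ℂ p μ) (b : Lp ℂ q μ), ‖lpDuality μ p q a b‖ ≤ ‖a‖ * ‖b‖ := fun a b =>
    ((lpDuality μ p q).le_opNorm₂ a b).trans (by
      gcongr
      exact mul_le_of_le_one_left (norm_nonneg _) norm_lpDuality_le)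
  rw [Metric.tendsto_nhds]
  intro ε hε
  -- The tolerances make each approximation error below at most `ε / 3`. That for `v` depends on
  -- `‖u‖`, hence the order of choice; the `+ 1` avoids a zero denominator.
  obtain ⟨u, hu, K, hK, huK⟩ := exists_compact_support_approx hp f
    (by positivity : 0 < ε / (3 * (‖g‖ + 1)))
  obtain ⟨v, hv, K', hK', hvK⟩ := exists_compact_support_approx hq g
    (by positivity : 0 < ε / (3 * (‖u‖ + 1)))
  -- If `x ∈ K'` and `t x ∈ K`, then `t = (t x) x⁻¹` lies in the compact set `K K'⁻¹`. For `t`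
  -- outside it, `L_t u` and `v` have disjoint supports.
  filter_upwards [(hK.mul hK'.inv).compl_mem_cocompact] with t ht
  have h0 : lpDuality μ p q (transl t u) v = 0 := by
    rw [lpDuality_apply]
    refine integral_eq_zero_of_ae ?_
    filter_upwards [coeFn_transl t u,
      (measurePreserving_mul_left μ t).quasiMeasurePreserving.ae huK, hvK] with x h1 h2 h3
    by_cases hx : x ∈ K'
    · have : t * x ∉ K := fun h => ht ⟨t * x, h, x⁻¹, by simpa using hx, by simp⟩
      simp [h1, h2 this]
    · simp [h3 hx]
  have h1 : lpDuality μ p q (transl t f) g =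
      lpDuality μ p q (transl t (f - u)) g + lpDuality μ p q (transl t u) (g - v) := by
    simp [h0]
  rw [dist_zero_right, h1]
  calc _ ≤ ‖lpDuality μ p q (transl t (f - u)) g‖ + ‖lpDuality μ p q (transl t u) (g - v)‖ :=
        norm_add_le _ _
    _ ≤ ‖f - u‖ * ‖g‖ + ‖u‖ * ‖g - v‖ := by
        refine add_le_add ((hB _ _).trans_eq ?_) ((hB _ _).trans_eq ?_) <;> rw [norm_transl]
    _ ≤ ε / (3 * (‖g‖ + 1)) * (‖g‖ + 1) + (‖u‖ + 1) * (ε / (3 * (‖u‖ + 1))) := by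
        gcongr <;> linarith
    _ = ε / 3 + ε / 3 := by field_simp
    _ < ε := by linarith

variable [Fact (p ≠ ∞)]

/-- A nuclear operator that is invariant under conjugation by the translations of a noncompact group
is zero. -/
theorem eq_zero_of_conj_eq [NoncompactSpace G] (hq : q ≠ ∞) {ρ : Nuclear (lpDuality μ p q)}
    (hρ : ∀ t, conj t ρ = ρ) : ρ = 0 := by
  apply toOp_injective
  refine ContinuousLinearMap.ext fun x => ?_
  obtain ⟨f, g, h⟩ := ρ.exists_rep
  -- Invariance under conjugation says that `ρ` commutes with the isometries `L_t`.
  have hcomm : ∀ t : G, ‖toOp _ ρ (transl t x)‖ = ‖toOp _ ρ x‖ := by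
    intro t
    have h1 : toOp _ ρ x = transl t⁻¹ (toOp _ ρ (transl t x)) := by
      conv_lhs => rw [← hρ t]
      rfl
    rw [h1, norm_transl]
  have hlim : Tendsto (fun t : G => toOp _ ρ (transl t x)) (cocompact G) (𝓝 0) := by
    have h2 : (fun t : G => toOp _ ρ (transl t x)) =
        fun t => ∑' n, lpDuality μ p q (transl t x) (g n) • f n :=
      funext fun t => (h.hasSum _).tsum_eq.symm
    rw [h2, ← tsum_zero (α := Lp ℂ p μ) (β := ℕ)]
    -- Weak convergence makes each term of the nuclear series tend to zero in norm; since the `L_t`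
    -- are isometries, `‖x‖ ‖f n‖ ‖g n‖` dominates uniformly in `t`.
    refine tendsto_tsum_of_dominated_convergence (h.summable.mul_left ‖x‖) (fun n => ?_)
      (Eventually.of_forall fun t n => ?_)
    · simpa using (tendsto_lpDuality_transl_cocompact (Fact.out : p ≠ ∞) hq x (g n)).smul_const
        (f n)
    · rw [norm_smul]
      calc _ ≤ ‖transl t x‖ * ‖g n‖ * ‖f n‖ := by gcongr; exact norm_pairing_le _ _ _
        _ = ‖x‖ * (‖f n‖ * ‖g n‖) := by rw [norm_transl]; ring
  have h3 := hlim.norm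
  simp only [hcomm, norm_zero] at h3
  -- A constant has limit zero along `cocompact G`, a nontrivial filter because `G` is noncompact.
  have h4 : ‖toOp _ ρ x‖ = 0 := tendsto_nhds_unique tendsto_const_nhds h3
  simpa using h4

/-- Since `1_K · 1_K = 1_K`, testing against `1_K ⊗ 1_K` reads off the integral over `K` of the
symbol of the multiplication operator. This is how an identity in the algebra becomes information
about the function `coef T ρ`. -/
theorem pair_odot_rankOne_indicator (T : Lp ℂ p μ →L[ℂ] Lp ℂ p μ)
    (ρ : Nuclear (lpDuality μ p q)) {K : Set G} (hK : MeasurableSet K) (hfin : μ K ≠ ∞) :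
    pair _ (odot T ρ) (rankOne (indicatorConstLp p hK hfin 1) (indicatorConstLp q hK hfin 1) :
      Nuclear (lpDuality μ p q)) = ∫ x in K, coef T ρ x ∂μ := by
  rw [pair_rankOne, lpDuality_indicatorConstLp_one]
  refine setIntegral_congr_ae hK ?_
  filter_upwards [coeFn_odot T ρ (indicatorConstLp p hK hfin 1),
    indicatorConstLp_coeFn (p := p) (hs := hK) (hμs := hfin) (c := (1 : ℂ))] with x h1 h2 hx
  rw [h1, h2, Set.indicator_of_mem hx, mul_one]

theorem Tr_rankOne_indicator {K : Set G} (hK : MeasurableSet K) (hfin : μ K ≠ ∞) :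
    Tr _ (rankOne (indicatorConstLp p hK hfin 1) (indicatorConstLp q hK hfin 1) :
      Nuclear (lpDuality μ p q)) = μ.real K := by
  rw [Tr_rankOne, lpDuality_indicatorConstLp_one]
  have : ∫ x in K, (indicatorConstLp p hK hfin (1 : ℂ)) x ∂μ = ∫ _ in K, (1 : ℂ) ∂μ := by
    refine setIntegral_congr_ae hK ?_
    filter_upwards [indicatorConstLp_coeFn (p := p) (hs := hK) (hμs := hfin) (c := (1 : ℂ))]
      with x h hx
    rw [h, Set.indicator_of_mem hx]
  rw [this, setIntegral_const]
  simp

variable (μ p q) in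
-- This supplies the linear splitting of the trace. A compact neighbourhood `K` of the identity has
-- positive finite Haar measure, so `1_K ⊗ 1_K` can be normalized.
theorem exists_Tr_eq_one : ∃ a : Nuclear (lpDuality μ p q), Tr _ a = 1 := by
  obtain ⟨K, hK, hKc, hK1⟩ := exists_mem_nhds_isCompact_isClosed (1 : G)
  have hfin : μ K ≠ ∞ := hKc.measure_lt_top.ne
  have hpos : μ K ≠ 0 := (Measure.measure_pos_of_mem_nhds μ hK).ne'
  refine ⟨(μ.real K : ℂ)⁻¹ • rankOne (indicatorConstLp p hK1.measurableSet hfin 1)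
    (indicatorConstLp q hK1.measurableSet hfin 1), ?_⟩
  rw [map_smul, Tr_rankOne_indicator, smul_eq_mul, inv_mul_cancel₀]
  exact Complex.ofReal_ne_zero.2 (ENNReal.toReal_pos hpos hfin).ne'

variable [Fact (q ≠ ∞)]

/-- If `ρ * a = Tr(a) ρ` for all `a`, then `ρ` commutes with all translations. -/
theorem conj_eq_of_mul_eq_smul {ρ : Nuclear (lpDuality μ p q)}
    (hρ : ∀ a, ρ * a = Tr _ a • ρ) (t : G) : conj t ρ = ρ := by
  refine ext_pair fun T => ?_
  rw [pair_conj]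
  -- The goal is now that `coef T ρ` takes the value `c` at `t`. If it does not, continuity keeps it
  -- within half the gap of `coef T ρ t` on a neighbourhood of `t`.
  set c := pair _ T ρ
  by_contra hne
  have hpos : 0 < ‖coef T ρ t - c‖ := norm_pos_iff.2 (sub_ne_zero.2 hne)
  have hnear : ∀ᶠ x in 𝓝 t, ‖coef T ρ x - coef T ρ t‖ < ‖coef T ρ t - c‖ / 2 := by
    have := (continuous_coef T ρ).tendsto t
    rw [tendsto_iff_norm_sub_tendsto_zero] at this
    exact this.eventually (gt_mem_nhds (half_pos hpos))
  obtain ⟨K, ⟨hKt, hKc, hK⟩, hKs⟩ := (isCompact_isClosed_basis_nhds t).mem_iff.1 hnear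
  have hfin : μ K ≠ ∞ := hKc.measure_lt_top.ne
  have hμ : 0 < μ.real K :=
    ENNReal.toReal_pos (Measure.measure_pos_of_mem_nhds μ hKt).ne' hfin
  -- The hypothesis with `a = 1_K ⊗ 1_K` says that the mean of `coef T ρ` over `K` is `c`.
  have hint : ∫ x in K, coef T ρ x ∂μ = μ.real K * c := by
    rw [← pair_odot_rankOne_indicator T ρ hK.measurableSet hfin, ← pair_conv, ← mul_eq_conv, hρ,
      map_smul, Tr_rankOne_indicator, smul_eq_mul]
  have hle := norm_setIntegral_le_of_norm_le_const (μ := μ) hKc.measure_lt_top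
    fun x hx => (hKs hx).le
  rw [integral_sub ((continuous_coef T ρ).continuousOn.integrableOn_compact' hKc hK.measurableSet)
    (integrableOn_const hfin), hint, setIntegral_const, Complex.real_smul, ← mul_sub, norm_mul,
    norm_sub_rev, Complex.norm_real, Real.norm_of_nonneg hμ.le] at hle
  -- With `δ` the gap between `coef T ρ t` and `c`, the mean value over `K` yields `μ(K) δ ≤ (δ / 2)
  -- μ(K)`, impossible for `δ, μ(K) > 0`.
  nlinarith [mul_pos hpos hμ]

end Translations

/-! ### The element `1 ⊗ 1` on a compact group, and the two implications. -/

section Compact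

open Nuclear

variable {G : Type*} [Group G] [TopologicalSpace G] [IsTopologicalGroup G]
  [LocallyCompactSpace G] [MeasurableSpace G] [BorelSpace G]
  {p : ℝ≥0∞} [Fact (1 < p)] {μ : Measure G} [μ.IsHaarMeasure] [μ.Regular] [Fact (p ≠ ∞)]

theorem transl_const {r : ℝ≥0∞} [Fact (1 ≤ r)] [IsFiniteMeasure μ] (t : G) (c : ℂ) :
    transl t (Lp.const r μ c) = Lp.const r μ c := by
  refine Lp.ext ?_
  filter_upwards [coeFn_transl t (Lp.const r μ c), Lp.coeFn_const r μ c,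
    (measurePreserving_mul_left μ t).quasiMeasurePreserving.ae (Lp.coeFn_const r μ c)]
    with x h1 h2 h3
  rw [h1, h2, h3]
  rfl

theorem Tr_oneTensorOne [IsFiniteMeasure μ] :
    Tr _ (oneTensorOne p μ) = (μ Set.univ).toReal := by
  rw [oneTensorOne, Tr_rankOne, lpDuality_apply]
  have : ∫ x, (Lp.const p μ (1 : ℂ)) x * (Lp.const (conjExp p) μ (1 : ℂ)) x ∂μ =
      ∫ _, (1 : ℂ) ∂μ := by
    refine integral_congr_ae ?_
    filter_upwards [Lp.coeFn_const p μ (1 : ℂ), Lp.coeFn_const (conjExp p) μ (1 : ℂ)]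
      with x h1 h2
    rw [h1, h2]
    simp
  rw [this, integral_const]
  simp [Measure.real]

/-- Translations fix the constants, so `1 ⊗ 1` has constant coefficient functions. Thus `T ⊙ (1 ⊗
1)` is a scalar operator, and pairing a scalar operator with `a` produces the factor `Tr a`. -/
theorem oneTensorOne_mul [IsFiniteMeasure μ] (a : NuclearAlgebra p μ) :
    oneTensorOne p μ * a = Tr _ a • oneTensorOne p μ := by
  refine ext_pair fun T => ?_
  have hcoef : ∀ t, coef T (oneTensorOne p μ) t = pair _ T (oneTensorOne p μ) := by
    intro t
    rw [coef, oneTensorOne, pair_rankOne, pair_rankOne]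
    simp only [ContinuousLinearMap.comp_apply]
    -- The outer `L_t` moves to the second tensor factor as `L_{t⁻¹}`, where it also meets a
    -- constant.
    rw [transl_adjoint, transl_const, transl_const]
  have hodot : odot T (oneTensorOne p μ) =
      pair _ T (oneTensorOne p μ) • ContinuousLinearMap.id ℂ _ := by
    refine ContinuousLinearMap.ext fun f => Lp.ext ?_
    filter_upwards [coeFn_odot T (oneTensorOne p μ) f,
      Lp.coeFn_smul (pair _ T (oneTensorOne p μ)) f] with t h1 h2
    rw [h1, hcoef]
    exact h2.symm
  rw [mul_eq_conv, pair_conv, hodot, map_smul, map_smul, _root_.smul_apply, pair_id, smul_eq_mul,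
    smul_eq_mul, mul_comm]

theorem traceModule_act (z : ℂ) (a : NuclearAlgebra p μ) :
    (traceModule p μ).act z a = z * Tr _ a := rfl

/-- The measure is not normalized here, so `e` is `1 ⊗ 1` divided by its trace `μ(G)`, which is
finite and nonzero for a compact group. -/
theorem isProjective_traceModule [CompactSpace G] : (traceModule p μ).IsProjective := by
  have hne : ((μ Set.univ).toReal : ℂ) ≠ 0 := by
    simpa using ENNReal.toReal_ne_zero.2
      ⟨isOpen_univ.measure_ne_zero μ Set.univ_nonempty, measure_ne_top _ _⟩
  refine RightBanachModule.isProjective_of_mul_eq_smul traceModule_act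
    (e := ((μ Set.univ).toReal : ℂ)⁻¹ • oneTensorOne p μ) ?_ fun a => ?_
  · rw [map_smul, Tr_oneTensorOne, smul_eq_mul, inv_mul_cancel₀ hne]
  · rw [smul_mul_assoc, oneTensorOne_mul, smul_comm]

/-- On a noncompact group the element `e` extracted from projectivity would be translation
invariant, hence zero, although its trace is `1`. -/
theorem compactSpace_of_isProjective (h : (traceModule p μ).IsProjective) : CompactSpace G := by
  by_contra hG
  have : NoncompactSpace G := not_compactSpace_iff.1 hG
  obtain ⟨a₀, ha₀⟩ := exists_Tr_eq_one μ p (conjExp p)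
  obtain ⟨e, he, hmul⟩ := h.exists_mul_eq_smul traceModule_act ha₀
  have h0 := eq_zero_of_conj_eq Fact.out (conj_eq_of_mul_eq_smul hmul)
  simp [h0] at he

end Compact

end NuclearConv

end

/-! ### The equivalence, and the explicit section of the trace. -/

theorem mainTheorem4 {G : Type*} [Group G] [TopologicalSpace G] [IsTopologicalGroup G]
    [LocallyCompactSpace G] [T2Space G] [MeasurableSpace G] [BorelSpace G]
    (μ : MeasureTheory.Measure G) [μ.IsHaarMeasure] [μ.Regular]
    (p : ENNReal) [Fact (1 < p)] [Fact (p ≠ ⊤)] :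
    ((NuclearConv.traceModule p μ).IsProjective ↔ CompactSpace G) ∧
    (∀ [CompactSpace G], μ Set.univ = 1 →
      ∃ s : NuclearConv.RightBanachModule.Hom (NuclearConv.traceModule p μ)
          (NuclearConv.RightBanachModule.self (NuclearConv.NuclearAlgebra p μ)),
        (∀ z : ℂ, s.1 z = z • NuclearConv.oneTensorOne p μ) ∧
        ∀ z : ℂ, NuclearConv.Nuclear.Tr _ (s.1 z) = z) := by
  refine ⟨⟨NuclearConv.compactSpace_of_isProjective,
    fun _ => NuclearConv.isProjective_traceModule⟩, fun h1 => ?_⟩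
  refine ⟨⟨ContinuousLinearMap.toSpanSingleton ℂ (NuclearConv.oneTensorOne p μ), fun z a => ?_⟩,
    fun z => rfl, fun z => ?_⟩
  -- Equivariance of the section is exactly the absorption identity `(1 ⊗ 1) * a = Tr(a) (1 ⊗ 1)`,
  -- which needs no normalization; `μ(G) = 1` is used only for the right-inverse property.
  · change (z * NuclearConv.Nuclear.Tr _ a) • NuclearConv.oneTensorOne p μ =
      (z • NuclearConv.oneTensorOne p μ) * a
    rw [smul_mul_assoc, NuclearConv.oneTensorOne_mul, smul_smul]
  · change NuclearConv.Nuclear.Tr _ (z • NuclearConv.oneTensorOne p μ) = z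
    simp [NuclearConv.Tr_oneTensorOne, h1]
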